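/- Let $X$ be a complex Banach space and fix $0<T<\infty$. A bounded analytic semigroup on $X$ is a family $(S(z))_{z\in\Sigma_\theta\cup\{0\}}$ of bounded operators, for some $0<\theta\le\pi/2$ and $\Sigma_\theta=\{z\ne0:|\arg z|<\theta\}$, such that $S(0)=I$, $S(z+w)=S(z)S(w)$, $z\mapsto S(z)$ is holomorphic and uniformly bounded on $\Sigma_\theta$, and $S(z)x\to x$ as $z\to0$ in $\Sigma_\theta$ for every $x\in X$; its generator is $x\mapsto\lim_{t\to0^+}(S(t)x-x)/t$, on the domain where this limit exists. An operator $B$ on $X$ such that $-B$ generates a bounded analytic semigroup satisfies (MR) if the operator $\frac{d}{dt}+B$ on $L^2([0,T);X)$, with domain $\{u\in W^{1,2}([0,T);X):u(0)=0\}\cap L^2([0,T);D(B))$, has a bounded inverse. The space $X$ has (MRP) if every $B$ such that $-B$ generates a bounded analytic semigroup on $X$ satisfies (MR). Let $(E_n)_{n\ge1}$ be a Schauder decomposition of $X$ (closed subspaces such that every $x\in X$ has a unique expansion $x=\sum_{n\ge1}x_n$ with $x_n\in E_n$, the series converging in norm), and let $P_n:x\mapsto x_n$ be the associated (bounded) projections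 of $X$ onto $E_n$. Let $Z_n=P_n^*X^*\subset X^*$, and write $[F,G]$ for the closed linear span of $F\cup G$. Assume that $X$ has (MRP). Then there is a constant $C>0$ such that for every $N$, whenever $u_n\in[E_{2n-1},E_{2n}]$ and $u_n^*\in[Z_{2n-1},Z_{2n}]$ for $1\le n\le N$, $$\left(\int_0^{2\pi}\Big\|\sum_{n=1}^N P_{2n}u_n\,e^{i2^nt}\Big\|^2\frac{dt}{2\pi}\right)^{1/2}\le C\left(\int_0^{2\pi}\Big\|\sum_{n=1}^N u_n\,e^{i2^nt}\Big\|^2\frac{dt}{2\pi}\right)^{1/2}$$ and $$\left(\int_0^{2\pi}\Big\|\sum_{n=1}^N P_{2n}^*u_n^*\,e^{i2^nt}\Big\|^2\frac{dt}{2\pi}\right)^{1/2}\le C\left(\int_0^{2\pi}\Big\|\sum_{n=1}^N u_n^*\,e^{i2^nt}\Big\|^2\frac{dt}{2\pi}\right)^{1/2}.$$ -/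

import Mathlib

open MeasureTheory Set Filter Topology

noncomputable section

/-- The open sector `{z ≠ 0 : |arg z| < θ}`. -/
def openSector (θ : ℝ) : Set ℂ := {z : ℂ | z ≠ 0 ∧ |z.arg| < θ}

/-- `S` is a bounded analytic semigroup on `X`: for some `θ ∈ (0, π/2]` it is holomorphic,
uniformly bounded and multiplicative on the sector of half-angle `θ`, with `S 0 = 1`, and
`S z x → x` as `z → 0` in the sector. Values of `S` outside the sector and `0` play no role. -/
def IsBoundedAnalyticSemigroup {X : Type*} [NormedAddCommGroup X] [NormedSpace ℂ X]
    (S : ℂ → X →L[ℂ] X) : Prop :=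
  ∃ θ : ℝ, 0 < θ ∧ θ ≤ Real.pi / 2 ∧
    S 0 = 1 ∧
    (∀ z ∈ openSector θ, ∀ w ∈ openSector θ, S (z + w) = (S z).comp (S w)) ∧
    DifferentiableOn ℂ S (openSector θ) ∧
    (∃ M : ℝ, ∀ z ∈ openSector θ, ‖S z‖ ≤ M) ∧
    (∀ x : X, Tendsto (fun z => S z x) (𝓝[openSector θ] 0) (𝓝 x))

/-- `G` is the infinitesimal generator of `(S t)_{t ≥ 0}`: `x ∈ D(G)` and `G x = y` exactly when
`(S t x - x) / t → y` as `t → 0+`. -/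
def IsInfinitesimalGenerator {X : Type*} [NormedAddCommGroup X] [NormedSpace ℂ X]
    (G : X →ₗ.[ℂ] X) (S : ℂ → X →L[ℂ] X) : Prop :=
  ∀ x y : X, (x, y) ∈ G.graph ↔
    Tendsto (fun t : ℝ => (t : ℂ)⁻¹ • (S (t : ℂ) x - x)) (𝓝[>] 0) (𝓝 y)

/-- `G` generates a bounded analytic semigroup. -/
def GeneratesBoundedAnalyticSemigroup {X : Type*} [NormedAddCommGroup X] [NormedSpace ℂ X]
    (G : X →ₗ.[ℂ] X) : Prop :=
  ∃ S : ℂ → X →L[ℂ] X, IsBoundedAnalyticSemigroup S ∧ IsInfinitesimalGenerator G S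

/-- The Bochner space `L²([0,T); X)`. -/
abbrev TimeL2 (T : ℝ) (X : Type*) [NormedAddCommGroup X] : Type _ :=
  Lp X 2 (volume.restrict (Ico (0 : ℝ) T))

/-- `u ∈ W₀^{1,2}([0,T); X) = {u ∈ W^{1,2}([0,T); X) : u 0 = 0}` and `u' = v`: here `v` is in
`L²([0,T); X)` and `u` is the primitive of `v` that vanishes at `0`. -/
def HasTimeDeriv {T : ℝ} {X : Type*} [NormedAddCommGroup X] [NormedSpace ℂ X]
    (u v : TimeL2 T X) : Prop :=
  ∀ᵐ t ∂(volume.restrict (Ico (0 : ℝ) T)), u t = ∫ s in (0 : ℝ)..t, v s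

/-- `u ∈ L²([0,T); D(B))` and `w(t) = B (u t)`, the function `w` being in `L²([0,T); X)`. -/
def HasTimeApply {T : ℝ} {X : Type*} [NormedAddCommGroup X] [NormedSpace ℂ X]
    (B : X →ₗ.[ℂ] X) (u w : TimeL2 T X) : Prop :=
  ∀ᵐ t ∂(volume.restrict (Ico (0 : ℝ) T)), (u t, w t) ∈ B.graph

/-- `B` has maximal regularity on `[0,T)`: the operator `d/dt + B` on `L²([0,T); X)`, with domain
`W₀^{1,2}([0,T); X) ∩ L²([0,T); D(B))`, has a bounded inverse `R`. -/
def MaximalRegularity (T : ℝ) {X : Type*} [NormedAddCommGroup X] [NormedSpace ℂ X]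
    (B : X →ₗ.[ℂ] X) : Prop :=
  ∃ R : TimeL2 T X →L[ℂ] TimeL2 T X, ∀ f u : TimeL2 T X,
    R f = u ↔ ∃ v w : TimeL2 T X, HasTimeDeriv u v ∧ HasTimeApply B u w ∧ v + w = f

/-- The maximal regularity property of `X` (on the time interval `[0,T)`): every `B` such that
`-B` generates a bounded analytic semigroup on `X` has maximal regularity. -/
def HasMRP (T : ℝ) (X : Type*) [NormedAddCommGroup X] [NormedSpace ℂ X] : Prop :=
  ∀ B : X →ₗ.[ℂ] X, GeneratesBoundedAnalyticSemigroup (-B) → MaximalRegularity T B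

/-- `(E_n)_{n ≥ 1}` is a Schauder decomposition of `X` with associated projections
`(P_n)_{n ≥ 1}`: the `E_n` are closed subspaces, and every `x` has a unique expansion
`x = ∑ e_n` with `e_n ∈ E_n`, namely the one with `e_n = P_n x`. (In a Banach space the associated
projections are automatically bounded.) The index `0` plays no role. -/
structure IsSchauderDecomposition {X : Type*} [NormedAddCommGroup X] [NormedSpace ℂ X]
    (E : ℕ → Submodule ℂ X) (P : ℕ → X →L[ℂ] X) : Prop where
  isClosed : ∀ n, 1 ≤ n → IsClosed (E n : Set X)
  mem : ∀ n, 1 ≤ n → ∀ x, P n x ∈ E n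
  tendsto : ∀ x, Tendsto (fun N : ℕ => ∑ n ∈ Finset.Icc 1 N, P n x) atTop (𝓝 x)
  unique : ∀ (x : X) (e : ℕ → X), (∀ n, 1 ≤ n → e n ∈ E n) →
    Tendsto (fun N : ℕ => ∑ n ∈ Finset.Icc 1 N, e n) atTop (𝓝 x) → ∀ n, 1 ≤ n → e n = P n x

/-- The Banach space adjoint `P^* : X^* → X^*`, `P^* φ = φ ∘ P`. -/
def dualAdjoint {X : Type*} [NormedAddCommGroup X] [NormedSpace ℂ X] (P : X →L[ℂ] X) :
    StrongDual ℂ X →L[ℂ] StrongDual ℂ X :=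
  P.precomp ℂ

/-- The subspace `P^* X^*` of `X^*`. -/
def dualRange {X : Type*} [NormedAddCommGroup X] [NormedSpace ℂ X] (P : X →L[ℂ] X) :
    Submodule ℂ (StrongDual ℂ X) :=
  LinearMap.range (dualAdjoint P : StrongDual ℂ X →ₗ[ℂ] StrongDual ℂ X)

/-- `[F, G]`: the closed linear span of two subspaces. -/
def closedSpan {Y : Type*} [NormedAddCommGroup Y] [NormedSpace ℂ Y] (F G : Submodule ℂ Y) :
    Submodule ℂ Y :=
  (Submodule.span ℂ ((F : Set Y) ∪ (G : Set Y))).topologicalClosure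

/-- The norm `(∫_0^{2π} ‖∑_{n=1}^N y_n e^{i 2^n t}‖² dt/2π)^{1/2}`. -/
def lacunaryNorm {Y : Type*} [NormedAddCommGroup Y] [NormedSpace ℂ Y] (N : ℕ) (y : ℕ → Y) : ℝ :=
  Real.sqrt (∫ t in (0 : ℝ)..(2 * Real.pi),
    ‖∑ n ∈ Finset.Icc 1 N, Complex.exp (Complex.I * 2 ^ n * t) • y n‖ ^ 2 / (2 * Real.pi))

end

/-!
Let `B` be the diagonal operator which acts on `E_k` as a multiple of `2 ^ ⌊k / 2⌋`. Summation by
parts shows that `-B` generates a bounded analytic semigroup, so `B` has maximal regularity on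
`[0, 2τ)`. A `τ`-periodic solution `g` of `g' + B g = f` differs from the solution which vanishes
at `0` by `e^{-tB} g(0)`, which is under control for `t ≥ τ`; hence `B (B + 2πij/τ)⁻¹` is a bounded
Fourier multiplier on the circle of length `τ`. At the frequency `2 ^ n` this multiplier acts on
`E_{2n-1}` as `1 / (1 + 2i)` and on `E_{2n}` as `1 / (1 + i)`, so that on `[E_{2n-1}, E_{2n}]` the
projection `P_{2n}` is a linear combination, independent of `n`, of the identity and the multiplier.
The adjoint of a bounded Fourier multiplier is a bounded Fourier multiplier on the dual space, which
gives the second inequality in the same way.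
-/

noncomputable section

section Projections

variable {X : Type*} [NormedAddCommGroup X] [NormedSpace ℂ X]

/-- The projections `p 0, p 1, …` of a Schauder decomposition, without reference to their ranges:
they are orthogonal idempotents whose partial sums converge strongly to the identity. -/
structure IsCoordinateProjections (p : ℕ → X →L[ℂ] X) : Prop extends OrthogonalIdempotents p where
  tendsto : ∀ x, Tendsto (fun n => ∑ k ∈ Finset.range n, p k x) atTop (𝓝 x)

theorem IsSchauderDecomposition.apply_of_mem {E : ℕ → Submodule ℂ X} {P : ℕ → X →L[ℂ] X}
    (h : IsSchauderDecomposition E P) {n : ℕ} (hn : 1 ≤ n) {x : X} (hx : x ∈ E n) {k : ℕ}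
    (hk : 1 ≤ k) : P k x = if k = n then x else 0 := by
  refine (h.unique x (fun k => if k = n then x else 0) (fun m _ => ?_) ?_ k hk).symm
  · split_ifs with hm
    · exact hm ▸ hx
    · exact zero_mem _
  · refine tendsto_const_nhds.congr' ?_
    filter_upwards [eventually_ge_atTop n] with N hN
    rw [Finset.sum_ite_eq', if_pos (Finset.mem_Icc.2 ⟨hn, hN⟩)]

theorem IsSchauderDecomposition.isCoordinateProjections {E : ℕ → Submodule ℂ X}
    {P : ℕ → X →L[ℂ] X} (h : IsSchauderDecomposition E P) :
    IsCoordinateProjections fun k => P (k + 1) where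
  toOrthogonalIdempotents := OrthogonalIdempotents.iff_mul_eq.2 fun k l => by
    ext x
    have hx := h.apply_of_mem l.succ_pos (h.mem (l + 1) l.succ_pos x) k.succ_pos
    simp only [mul_apply_eq_comp, hx, Nat.succ_inj]
    split_ifs with hkl <;> simp [hkl]
  tendsto x := by
    refine (h.tendsto x).congr fun n => ?_
    rw [Finset.range_eq_Ico, Finset.sum_Ico_add' (fun k => P k x) 0 n 1]
    rfl

namespace IsCoordinateProjections

variable {p : ℕ → X →L[ℂ] X}

theorem eq_of_forall_apply_eq (h : IsCoordinateProjections p) {x y : X}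
    (hxy : ∀ k, p k x = p k y) : x = y :=
  tendsto_nhds_unique (h.tendsto x) (by simpa only [hxy] using h.tendsto y)

theorem exists_norm_sum_le [CompleteSpace X] (h : IsCoordinateProjections p) :
    ∃ K, ∀ n, ‖∑ k ∈ Finset.range n, p k‖ ≤ K :=
  banach_steinhaus fun x => by
    obtain ⟨C, hC⟩ := (h.tendsto x).norm.bddAbove_range
    exact ⟨C, fun n => by simpa only [sum_apply] using hC ⟨n, rfl⟩⟩

end IsCoordinateProjections

/-- The finite diagonal operator `∑_{k < n} c_k p_k`. -/
def truncatedDiagonal (p : ℕ → X →L[ℂ] X) (c : ℕ → ℂ) (n : ℕ) : X →L[ℂ] X :=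
  ∑ k ∈ Finset.range n, c k • p k

theorem truncatedDiagonal_apply (p : ℕ → X →L[ℂ] X) (c : ℕ → ℂ) (n : ℕ) (x : X) :
    truncatedDiagonal p c n x = ∑ k ∈ Finset.range n, c k • p k x := by
  simp only [truncatedDiagonal, sum_apply, smul_apply]

theorem truncatedDiagonal_one (p : ℕ → X →L[ℂ] X) (n : ℕ) :
    truncatedDiagonal p 1 n = ∑ k ∈ Finset.range n, p k := by
  simp only [truncatedDiagonal, Pi.one_apply, one_smul]

theorem truncatedDiagonal_add (p : ℕ → X →L[ℂ] X) (c d : ℕ → ℂ) (n : ℕ) :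
    truncatedDiagonal p (c + d) n = truncatedDiagonal p c n + truncatedDiagonal p d n := by
  simp only [truncatedDiagonal, Pi.add_apply, add_smul, Finset.sum_add_distrib]

theorem truncatedDiagonal_smul (p : ℕ → X →L[ℂ] X) (a : ℂ) (c : ℕ → ℂ) (n : ℕ) :
    truncatedDiagonal p (a • c) n = a • truncatedDiagonal p c n := by
  simp only [truncatedDiagonal, Pi.smul_apply, smul_assoc, Finset.smul_sum]

section OrthogonalIdempotents

variable {p : ℕ → X →L[ℂ] X}

theorem mul_truncatedDiagonal (hp : OrthogonalIdempotents p) (c : ℕ → ℂ) (k n : ℕ) :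
    p k * truncatedDiagonal p c n = if k < n then c k • p k else 0 := by
  simp only [truncatedDiagonal, Finset.mul_sum, mul_smul_comm, hp.mul_eq, smul_ite, smul_zero,
    Finset.sum_ite_eq, Finset.mem_range]

theorem truncatedDiagonal_mul (hp : OrthogonalIdempotents p) (c : ℕ → ℂ) (k n : ℕ) :
    truncatedDiagonal p c n * p k = if k < n then c k • p k else 0 := by
  simp only [truncatedDiagonal, Finset.sum_mul, smul_mul_assoc, hp.mul_eq, smul_ite, smul_zero,
    Finset.sum_ite_eq', Finset.mem_range]

theorem truncatedDiagonal_mul_truncatedDiagonal (hp : OrthogonalIdempotents p) (c d : ℕ → ℂ)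
    (n : ℕ) :
    truncatedDiagonal p c n * truncatedDiagonal p d n = truncatedDiagonal p (c * d) n := by
  rw [truncatedDiagonal, Finset.sum_mul, truncatedDiagonal.eq_def p (c * d)]
  refine Finset.sum_congr rfl fun k hk => ?_
  rw [smul_mul_assoc, mul_truncatedDiagonal hp, if_pos (Finset.mem_range.1 hk), smul_smul,
    Pi.mul_apply]

end OrthogonalIdempotents

theorem truncatedDiagonal_succ_eq_by_parts (p : ℕ → X →L[ℂ] X) (c : ℕ → ℂ) (n : ℕ) :
    truncatedDiagonal p c (n + 1) = c n • ∑ k ∈ Finset.range (n + 1), p k +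
      ∑ k ∈ Finset.range n, (c k - c (k + 1)) • ∑ l ∈ Finset.range (k + 1), p l := by
  rw [truncatedDiagonal, Finset.sum_range_by_parts, Nat.add_sub_cancel, sub_eq_add_neg,
    ← Finset.sum_neg_distrib]
  simp only [← neg_smul, neg_sub]

/-- `c` is a null sequence of total variation at most `V`. -/
structure IsNullOfVariationLE (c : ℕ → ℂ) (V : ℝ) : Prop where
  tendsto_zero : Tendsto c atTop (𝓝 0)
  sum_norm_sub_le : ∀ n, ∑ k ∈ Finset.range n, ‖c k - c (k + 1)‖ ≤ V

theorem IsNullOfVariationLE.mono {c : ℕ → ℂ} {V W : ℝ} (hc : IsNullOfVariationLE c V)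
    (hVW : V ≤ W) : IsNullOfVariationLE c W :=
  ⟨hc.tendsto_zero, fun n => (hc.sum_norm_sub_le n).trans hVW⟩

theorem IsNullOfVariationLE.of_norm_sub_le {c : ℕ → ℂ} {a : ℕ → ℝ} {L : ℝ} (hL : 0 ≤ L)
    (ha : ∀ k, 0 ≤ a k) (hc : Tendsto c atTop (𝓝 0))
    (hca : ∀ k, ‖c k - c (k + 1)‖ ≤ L * (a k - a (k + 1))) :
    IsNullOfVariationLE c (L * a 0) where
  tendsto_zero := hc
  sum_norm_sub_le n := calc
    _ ≤ ∑ k ∈ Finset.range n, L * (a k - a (k + 1)) := Finset.sum_le_sum fun k _ => hca k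
    _ = L * (a 0 - a n) := by rw [← Finset.mul_sum, Finset.sum_range_sub']
    _ ≤ L * a 0 := by gcongr; linarith [ha n]

theorem IsNullOfVariationLE.of_antitone {a : ℕ → ℝ} (ha : Antitone a)
    (h0 : Tendsto a atTop (𝓝 0)) : IsNullOfVariationLE (fun k => (a k : ℂ)) (a 0) := by
  rw [← one_mul (a 0)]
  refine .of_norm_sub_le zero_le_one (fun k => ha.le_of_tendsto h0 k) (by exact_mod_cast h0.ofReal)
    fun k => ?_
  rw [← Complex.ofReal_sub, Complex.norm_real, one_mul,
    Real.norm_of_nonneg (sub_nonneg.2 (ha k.le_succ))]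

/-- The diagonal operator `∑_k c_k p_k` of a null sequence `c` of bounded variation. It is defined
by the series obtained from summation by parts, which converges absolutely. -/
def diagonalMultiplier (p : ℕ → X →L[ℂ] X) (c : ℕ → ℂ) : X →L[ℂ] X :=
  ∑' k, (c k - c (k + 1)) • ∑ l ∈ Finset.range (k + 1), p l

namespace IsNullOfVariationLE

variable {p : ℕ → X →L[ℂ] X} {c : ℕ → ℂ} {K V : ℝ}

theorem sum_norm_smul_sum_le (hc : IsNullOfVariationLE c V)
    (hK : ∀ n, ‖∑ k ∈ Finset.range n, p k‖ ≤ K) (n : ℕ) :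
    ∑ k ∈ Finset.range n, ‖(c k - c (k + 1)) • ∑ l ∈ Finset.range (k + 1), p l‖ ≤ V * K := calc
  _ ≤ ∑ k ∈ Finset.range n, ‖c k - c (k + 1)‖ * K :=
    Finset.sum_le_sum fun k _ => by rw [norm_smul]; gcongr; exact hK _
  _ ≤ V * K := by
    rw [← Finset.sum_mul]
    exact mul_le_mul_of_nonneg_right (hc.sum_norm_sub_le n) ((norm_nonneg _).trans (hK 0))

theorem summable_norm_smul_sum (hc : IsNullOfVariationLE c V)
    (hK : ∀ n, ‖∑ k ∈ Finset.range n, p k‖ ≤ K) :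
    Summable fun k => ‖(c k - c (k + 1)) • ∑ l ∈ Finset.range (k + 1), p l‖ :=
  summable_of_sum_range_le (fun _ => norm_nonneg _) (hc.sum_norm_smul_sum_le hK)

theorem norm_diagonalMultiplier_le (hc : IsNullOfVariationLE c V)
    (hK : ∀ n, ‖∑ k ∈ Finset.range n, p k‖ ≤ K) : ‖diagonalMultiplier p c‖ ≤ V * K :=
  (norm_tsum_le_tsum_norm (hc.summable_norm_smul_sum hK)).trans
    (Real.tsum_le_of_sum_range_le (fun _ => norm_nonneg _) (hc.sum_norm_smul_sum_le hK))

theorem tendsto_truncatedDiagonal [CompleteSpace X] (hc : IsNullOfVariationLE c V)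
    (hK : ∀ n, ‖∑ k ∈ Finset.range n, p k‖ ≤ K) :
    Tendsto (truncatedDiagonal p c) atTop (𝓝 (diagonalMultiplier p c)) := by
  have hboundary : Tendsto (fun n => c n • ∑ k ∈ Finset.range (n + 1), p k) atTop (𝓝 0) :=
    hc.tendsto_zero.zero_smul_isBoundedUnder_le (isBoundedUnder_of ⟨K, fun n => hK (n + 1)⟩)
  have hseries := (hc.summable_norm_smul_sum hK).of_norm.hasSum.tendsto_sum_nat
  rw [← tendsto_add_atTop_iff_nat 1]
  simp only [truncatedDiagonal_succ_eq_by_parts]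
  simpa only [zero_add] using! hboundary.add hseries

end IsNullOfVariationLE

theorem norm_truncatedDiagonal_le_of_antitone {p : ℕ → X →L[ℂ] X} {K : ℝ}
    (hK : ∀ n, ‖∑ k ∈ Finset.range n, p k‖ ≤ K) {a : ℕ → ℝ} (ha : Antitone a)
    (ha0 : ∀ k, 0 ≤ a k) (n : ℕ) : ‖truncatedDiagonal p (fun k => (a k : ℂ)) n‖ ≤ a 0 * K := by
  cases n with
  | zero => simpa [truncatedDiagonal] using mul_nonneg (ha0 0) ((norm_nonneg _).trans (hK 0))
  | succ n =>
    rw [truncatedDiagonal_succ_eq_by_parts]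
    calc _ ≤ a n * K + ∑ k ∈ Finset.range n, (a k - a (k + 1)) * K := by
          refine norm_add_le_of_le ?_ (norm_sum_le_of_le _ fun k _ => ?_)
          · rw [norm_smul, Complex.norm_real, Real.norm_of_nonneg (ha0 n)]
            exact mul_le_mul_of_nonneg_left (hK _) (ha0 n)
          · have hk := sub_nonneg.2 (ha k.le_succ)
            rw [norm_smul, ← Complex.ofReal_sub, Complex.norm_real, Real.norm_of_nonneg hk]
            exact mul_le_mul_of_nonneg_left (hK _) hk
      _ = a 0 * K := by rw [← Finset.sum_mul, Finset.sum_range_sub']; ring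

namespace IsCoordinateProjections

variable [CompleteSpace X] {p : ℕ → X →L[ℂ] X}

theorem apply_diagonalMultiplier (h : IsCoordinateProjections p) {c : ℕ → ℂ} {V : ℝ}
    (hc : IsNullOfVariationLE c V) (k : ℕ) (x : X) :
    p k (diagonalMultiplier p c x) = c k • p k x := by
  obtain ⟨K, hK⟩ := h.exists_norm_sum_le
  have hmul : p k * diagonalMultiplier p c = c k • p k := by
    refine tendsto_nhds_unique ((hc.tendsto_truncatedDiagonal hK).const_mul (p k))
      (tendsto_const_nhds.congr' ?_)
    filter_upwards [eventually_gt_atTop k] with n hn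
    rw [mul_truncatedDiagonal h.toOrthogonalIdempotents, if_pos hn]
  exact congr($hmul x)

theorem diagonalMultiplier_apply (h : IsCoordinateProjections p) {c : ℕ → ℂ} {V : ℝ}
    (hc : IsNullOfVariationLE c V) (k : ℕ) (x : X) :
    diagonalMultiplier p c (p k x) = c k • p k x := by
  refine h.eq_of_forall_apply_eq fun l => ?_
  rw [h.apply_diagonalMultiplier hc, map_smul, ← mul_apply_eq_comp, h.mul_eq]
  split_ifs with hlk
  · rw [hlk]
  · simp only [zero_apply, smul_zero]

theorem diagonalMultiplier_mul_diagonalMultiplier (h : IsCoordinateProjections p) {c d e : ℕ → ℂ}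
    {U V W : ℝ} (hc : IsNullOfVariationLE c U) (hd : IsNullOfVariationLE d V)
    (he : IsNullOfVariationLE e W) (hcd : ∀ k, c k * d k = e k) :
    diagonalMultiplier p c * diagonalMultiplier p d = diagonalMultiplier p e := by
  ext x
  refine h.eq_of_forall_apply_eq fun k => ?_
  rw [mul_apply_eq_comp, h.apply_diagonalMultiplier hc, h.apply_diagonalMultiplier hd,
    h.apply_diagonalMultiplier he, smul_smul, hcd]

theorem tendsto_diagonalMultiplier_apply (h : IsCoordinateProjections p) {ι : Type*}
    {l : Filter ι} {c : ι → ℕ → ℂ} {V : ℝ} (hc : ∀ᶠ i in l, IsNullOfVariationLE (c i) V)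
    (hc1 : ∀ k, Tendsto (fun i => c i k) l (𝓝 1)) (x : X) :
    Tendsto (fun i => diagonalMultiplier p (c i) x) l (𝓝 x) := by
  obtain ⟨K, hK⟩ := h.exists_norm_sum_le
  refine TendstoUniformlyOnFilter.tendsto_of_eventually_tendsto (p := atTop)
    (F := fun n i => diagonalMultiplier p (c i) (∑ k ∈ Finset.range n, p k x))
    (L := fun n => ∑ k ∈ Finset.range n, p k x) ?_ (Eventually.of_forall fun n => ?_)
    (h.tendsto x)
  · rw [Metric.tendstoUniformlyOnFilter_iff]
    intro ε hε
    have hsmall : Tendsto (fun n => V * K * ‖x - ∑ k ∈ Finset.range n, p k x‖) atTop (𝓝 0) := by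
      simpa using (((h.tendsto x).const_sub x).norm).const_mul (V * K)
    refine ((hsmall.eventually (gt_mem_nhds hε)).prod_mk hc).mono fun ⟨n, i⟩ ⟨hn, hi⟩ => ?_
    rw [dist_eq_norm, ← map_sub]
    exact ((diagonalMultiplier p (c i)).le_of_opNorm_le
      (hi.norm_diagonalMultiplier_le hK) _).trans_lt hn
  · have hsum : Tendsto (fun i => ∑ k ∈ Finset.range n, c i k • p k x) l
        (𝓝 (∑ k ∈ Finset.range n, (1 : ℂ) • p k x)) :=
      tendsto_finsetSum _ fun k _ => (hc1 k).smul_const _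
    simp only [one_smul] at hsum
    refine hsum.congr' (hc.mono fun i hi => ?_)
    simp only [map_sum, h.diagonalMultiplier_apply hi]

end IsCoordinateProjections

end Projections

theorem norm_exp_neg_mul_sub_le {z : ℂ} {r : ℝ} (hr : 0 < r) (hz : r ≤ z.re) {a b : ℝ}
    (ha : 0 ≤ a) (hab : a ≤ b) :
    ‖Complex.exp (-(a * z)) - Complex.exp (-(b * z))‖ ≤
      ‖z‖ / r * (Real.exp (-(a * r)) - Real.exp (-(b * r))) := by
  have hf (s : ℝ) : HasDerivAt (fun s : ℝ => Complex.exp (-(a * z)) - Complex.exp (-(s * z)))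
      (z * Complex.exp (-(s * z))) s := by
    convert! ((((hasDerivAt_id s).ofReal_comp).mul_const z).neg.cexp).const_sub
      (Complex.exp (-(a * z))) using 1
    simp only [id_eq, Pi.neg_apply, Complex.ofReal_one]
    ring
  have hB (s : ℝ) : HasDerivAt
      (fun s : ℝ => ‖z‖ / r * (Real.exp (-(a * r)) - Real.exp (-(s * r))))
      (‖z‖ * Real.exp (-(s * r))) s := by
    convert! ((((hasDerivAt_id s).mul_const r).neg.exp).const_sub
      (Real.exp (-(a * r)))).const_mul (‖z‖ / r) using 1
    simp only [id_eq, Pi.neg_apply]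
    field_simp
  refine image_norm_le_of_norm_deriv_right_le_deriv_boundary
    (fun s _ => (hf s).continuousAt.continuousWithinAt) (fun s _ => (hf s).hasDerivWithinAt)
    (by simp) hB (fun s hs => ?_) (right_mem_Icc.2 hab)
  rw [norm_mul, Complex.norm_exp, Complex.neg_re, Complex.re_ofReal_mul]
  have := ha.trans hs.1
  gcongr

theorem re_pos_of_mem_openSector {θ : ℝ} (hθ : θ ≤ Real.pi / 2) {z : ℂ} (hz : z ∈ openSector θ) :
    0 < z.re :=
  ((Complex.abs_arg_lt_pi_div_two_iff.1 (hz.2.trans_le hθ)).resolve_right hz.1)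

theorem norm_mul_cos_le_re_of_mem_openSector {θ : ℝ} (hθ : θ ≤ Real.pi) {z : ℂ}
    (hz : z ∈ openSector θ) : ‖z‖ * Real.cos θ ≤ z.re := calc
  _ ≤ ‖z‖ * Real.cos |z.arg| := by
    gcongr
    exact Real.cos_le_cos_of_nonneg_of_le_pi (abs_nonneg _) hθ hz.2.le
  _ = z.re := by rw [Real.cos_abs, Complex.norm_mul_cos_arg]

/-- An increasing sequence of positive reals that tends to infinity; such a sequence consists of
the eigenvalues of the diagonal operators considered here. -/
structure IsEigenvalueSequence (b : ℕ → ℝ) : Prop where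
  pos : ∀ k, 0 < b k
  monotone : Monotone b
  tendsto : Tendsto b atTop atTop

theorem IsEigenvalueSequence.isNullOfVariationLE_exp {b : ℕ → ℝ} (hb : IsEigenvalueSequence b)
    {z : ℂ} (hz : 0 < z.re) :
    IsNullOfVariationLE (fun k => Complex.exp (-(b k * z))) (‖z‖ / z.re) := by
  refine IsNullOfVariationLE.mono (.of_norm_sub_le (by positivity) (fun k => (Real.exp_pos _).le) ?_
    fun k => norm_exp_neg_mul_sub_le hz le_rfl (hb.pos k).le (hb.monotone k.le_succ)) ?_
  · rw [tendsto_zero_iff_norm_tendsto_zero]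
    simpa [Complex.norm_exp, Function.comp_def] using
      Real.tendsto_exp_neg_atTop_nhds_zero.comp (hb.tendsto.atTop_mul_const hz)
  · exact mul_le_of_le_one_right (by positivity)
      (Real.exp_le_one_iff.2 (neg_nonpos.2 (mul_pos (hb.pos 0) hz).le))

section Generation

variable {X : Type*} [NormedAddCommGroup X] [NormedSpace ℂ X]
  {p : ℕ → X →L[ℂ] X} {b : ℕ → ℝ}

/-- The semigroup `z ↦ ∑_k e^{-b_k z} p_k`. The coefficients form a null sequence only for
`0 < Re z`, so that the value at `0` is prescribed separately. -/
def diagonalSemigroup (p : ℕ → X →L[ℂ] X) (b : ℕ → ℝ) (z : ℂ) : X →L[ℂ] X :=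
  if z = 0 then 1 else diagonalMultiplier p fun k => Complex.exp (-(b k * z))

theorem diagonalSemigroup_of_re_pos {z : ℂ} (hz : 0 < z.re) :
    diagonalSemigroup p b z = diagonalMultiplier p fun k => Complex.exp (-(b k * z)) :=
  if_neg (by rintro rfl; exact hz.false)

theorem differentiableAt_diagonalMultiplier_exp [CompleteSpace X] (hp : IsCoordinateProjections p)
    (hb : IsEigenvalueSequence b) {z : ℂ} (hz : 0 < z.re) :
    DifferentiableAt ℂ (fun w => diagonalMultiplier p fun k => Complex.exp (-(b k * w))) z := by
  obtain ⟨K, hK⟩ := hp.exists_norm_sum_le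
  obtain ⟨r, hr, hrz⟩ := exists_between hz
  let U : Set ℂ := {w | r < w.re} ∩ Metric.ball 0 (‖z‖ + 1)
  have hU : IsOpen U :=
    (isOpen_lt continuous_const Complex.continuous_re).inter Metric.isOpen_ball
  have hzU : z ∈ U := ⟨hrz, mem_ball_zero_iff.2 (lt_add_one _)⟩
  let a (k : ℕ) : ℝ := Real.exp (-(b k * r))
  have ha : Antitone a := fun k l hkl => Real.exp_le_exp.2 (by have := hb.monotone hkl; gcongr)
  have hsum : Summable fun k => a k - a (k + 1) :=
    summable_of_sum_range_le (c := a 0) (fun k => sub_nonneg.2 (ha k.le_succ)) fun n => by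
      rw [Finset.sum_range_sub']
      exact sub_le_self _ (Real.exp_pos _).le
  refine (Complex.differentiableOn_tsum_of_summable_norm
    ((hsum.mul_left ((‖z‖ + 1) / r)).mul_right K) (fun k => ?_) hU
    fun k w hw => ?_).differentiableAt (hU.mem_nhds hzU)
  · exact Differentiable.differentiableOn (by fun_prop)
  · have hwz : ‖w‖ ≤ ‖z‖ + 1 := (mem_ball_zero_iff.1 hw.2).le
    rw [norm_smul]
    refine mul_le_mul ?_ (hK _) (norm_nonneg _)
      (mul_nonneg (by positivity) (sub_nonneg.2 (ha k.le_succ)))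
    refine (norm_exp_neg_mul_sub_le hr hw.1.le (hb.pos k).le (hb.monotone k.le_succ)).trans ?_
    exact mul_le_mul_of_nonneg_right (by gcongr) (sub_nonneg.2 (ha k.le_succ))

theorem isBoundedAnalyticSemigroup_diagonalSemigroup [CompleteSpace X]
    (hp : IsCoordinateProjections p) (hb : IsEigenvalueSequence b) :
    IsBoundedAnalyticSemigroup (diagonalSemigroup p b) := by
  obtain ⟨K, hK⟩ := hp.exists_norm_sum_le
  let θ : ℝ := Real.pi / 3
  have hθ : θ ≤ Real.pi / 2 := by simp only [θ]; linarith [Real.pi_pos]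
  have hre {z : ℂ} (hz : z ∈ openSector θ) : 0 < z.re := re_pos_of_mem_openSector hθ hz
  have hnull {z : ℂ} (hz : z ∈ openSector θ) :
      IsNullOfVariationLE (fun k => Complex.exp (-(b k * z))) 2 := by
    refine (hb.isNullOfVariationLE_exp (hre hz)).mono ((div_le_iff₀ (hre hz)).2 ?_)
    have := norm_mul_cos_le_re_of_mem_openSector (hθ.trans (by linarith [Real.pi_pos])) hz
    rw [Real.cos_pi_div_three] at this
    linarith
  refine ⟨θ, by positivity, hθ, if_pos rfl, fun z hz w hw => ?_, ?_, ⟨2 * K, fun z hz => ?_⟩,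
    fun x => ?_⟩
  · have hzw : 0 < (z + w).re := add_pos (hre hz) (hre hw)
    rw [diagonalSemigroup_of_re_pos hzw, diagonalSemigroup_of_re_pos (hre hz),
      diagonalSemigroup_of_re_pos (hre hw)]
    refine (hp.diagonalMultiplier_mul_diagonalMultiplier (hnull hz) (hnull hw)
      (hb.isNullOfVariationLE_exp hzw) fun k => ?_).symm
    rw [← Complex.exp_add]
    ring_nf
  · refine DifferentiableOn.congr (f := fun z => diagonalMultiplier p fun k =>
      Complex.exp (-(b k * z))) (fun z hz => ?_) fun z hz => diagonalSemigroup_of_re_pos (hre hz)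
    exact (differentiableAt_diagonalMultiplier_exp hp hb (hre hz)).differentiableWithinAt
  · rw [diagonalSemigroup_of_re_pos (hre hz)]
    exact (hnull hz).norm_diagonalMultiplier_le hK
  · refine (hp.tendsto_diagonalMultiplier_apply (V := 2)
      (eventually_mem_nhdsWithin.mono fun z hz => hnull hz) (fun k => ?_) x).congr'
      (eventually_mem_nhdsWithin.mono fun z hz =>
        congr($(diagonalSemigroup_of_re_pos (hre hz)) x).symm)
    exact ((by fun_prop : Continuous fun z : ℂ => Complex.exp (-(b k * z))).tendsto' 0 1
      (by simp)).mono_left nhdsWithin_le_nhds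

theorem antitone_slope_exp_neg (hb : IsEigenvalueSequence b) {t : ℝ} (ht : 0 < t) :
    Antitone fun k => slope Real.exp 0 (-(b k * t)) := fun k l hkl => by
  have hneg (k : ℕ) : -(b k * t) ≠ 0 := (neg_neg_of_pos (mul_pos (hb.pos k) ht)).ne
  exact convexOn_exp.slope_mono (mem_univ 0) ⟨mem_univ _, hneg l⟩ ⟨mem_univ _, hneg k⟩
    (by have := hb.monotone hkl; gcongr)

theorem isNullOfVariationLE_slope_exp (hb : IsEigenvalueSequence b) {t : ℝ} (ht : 0 < t) :
    IsNullOfVariationLE (fun k => (slope Real.exp 0 (-(b k * t)) : ℂ)) 1 := by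
  have hpos (k : ℕ) : 0 < b k * t := mul_pos (hb.pos k) ht
  have heq (k : ℕ) : slope Real.exp 0 (-(b k * t)) = (1 - Real.exp (-(b k * t))) / (b k * t) := by
    rw [slope_def_field, Real.exp_zero, sub_zero, ← neg_sub, neg_div_neg_eq]
  have hzero : Tendsto (fun k => slope Real.exp 0 (-(b k * t))) atTop (𝓝 0) := by
    refine squeeze_zero (fun k => ?_) (fun k => ?_)
      (tendsto_inv_atTop_zero.comp (hb.tendsto.atTop_mul_const ht))
    · rw [heq]
      exact div_nonneg (sub_nonneg.2 (Real.exp_le_one_iff.2 (neg_nonpos.2 (hpos k).le)))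
        (hpos k).le
    · rw [heq, Function.comp_apply, inv_eq_one_div]
      exact div_le_div_of_nonneg_right (sub_le_self _ (Real.exp_pos _).le) (hpos k).le
  refine (IsNullOfVariationLE.of_antitone (antitone_slope_exp_neg hb ht) hzero).mono ?_
  rw [heq, div_le_one (hpos 0)]
  linarith [Real.add_one_le_exp (-(b 0 * t))]

theorem tendsto_slope_exp_neg_mul {β : ℝ} (hβ : 0 < β) :
    Tendsto (fun t => slope Real.exp 0 (-(β * t))) (𝓝[>] 0) (𝓝 1) := by
  have hslope := (Real.hasDerivAt_exp 0).tendsto_slope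
  rw [Real.exp_zero] at hslope
  refine hslope.comp (tendsto_nhdsWithin_iff.2 ⟨?_, ?_⟩)
  · exact ((by fun_prop : Continuous fun t : ℝ => -(β * t)).tendsto' 0 0
      (by simp)).mono_left nhdsWithin_le_nhds
  · filter_upwards [self_mem_nhdsWithin] with t ht
    exact (neg_neg_of_pos (mul_pos hβ ht)).ne

theorem neg_mul_mul_slope_exp_neg (β t : ℝ) :
    -t * (slope Real.exp 0 (-(β * t)) * β) = Real.exp (-(β * t)) - 1 := by
  have h := sub_smul_slope Real.exp 0 (-(β * t))
  rw [sub_zero, smul_eq_mul, vsub_eq_sub, Real.exp_zero] at h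
  linear_combination h

/-- The graph `{(x, y) : p_k y = b_k p_k x for all k}` of the diagonal operator. -/
def diagonalGraph (p : ℕ → X →L[ℂ] X) (b : ℕ → ℝ) : Submodule ℂ (X × X) where
  carrier := {z | ∀ k, p k z.2 = (b k : ℂ) • p k z.1}
  add_mem' hz hw k := by simp only [Prod.fst_add, Prod.snd_add, map_add, smul_add, hz k, hw k]
  zero_mem' k := by simp
  smul_mem' a z hz k := by simp only [Prod.smul_fst, Prod.smul_snd, map_smul, hz k, smul_comm a]

/-- The unbounded operator `x ↦ ∑_k b_k p_k x` with its maximal domain. -/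
def diagonalOperator (p : ℕ → X →L[ℂ] X) (b : ℕ → ℝ) : X →ₗ.[ℂ] X :=
  (diagonalGraph p b).toLinearPMap

theorem mem_graph_diagonalOperator (hp : IsCoordinateProjections p) {x y : X} :
    (x, y) ∈ (diagonalOperator p b).graph ↔ ∀ k, p k y = (b k : ℂ) • p k x := by
  rw [diagonalOperator, Submodule.toLinearPMap_graph_eq]
  · rfl
  · exact fun z hz hz1 => hp.eq_of_forall_apply_eq fun k => by
      rw [hz k, hz1, map_zero, smul_zero]

theorem apply_mem_graph_diagonalOperator (hp : IsCoordinateProjections p) (k : ℕ) (x : X) :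
    (p k x, (b k : ℂ) • p k x) ∈ (diagonalOperator p b).graph := by
  refine (mem_graph_diagonalOperator hp).2 fun l => ?_
  rw [map_smul, ← mul_apply_eq_comp, hp.mul_eq]
  split_ifs with hlk
  · rw [hlk]
  · simp only [zero_apply, smul_zero]

theorem isClosed_diagonalOperator (hp : IsCoordinateProjections p) :
    (diagonalOperator p b).IsClosed := by
  have hgraph : ((diagonalOperator p b).graph : Set (X × X)) =
      ⋂ k, {z | p k z.2 = (b k : ℂ) • p k z.1} := by
    ext z
    rw [mem_iInter]
    exact mem_graph_diagonalOperator hp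
  rw [LinearPMap.IsClosed, hgraph]
  exact isClosed_iInter fun k => isClosed_eq (by fun_prop) (by fun_prop)

theorem diagonalSemigroup_sub_eq_of_mem_graph [CompleteSpace X] (hp : IsCoordinateProjections p)
    (hb : IsEigenvalueSequence b) {x y : X} (hxy : (x, y) ∈ (diagonalOperator p b).graph) {t : ℝ}
    (ht : 0 < t) : diagonalSemigroup p b t x - x =
      -(t : ℂ) • diagonalMultiplier p (fun k => (slope Real.exp 0 (-(b k * t)) : ℂ)) y := by
  have ht' : 0 < (t : ℂ).re := ht
  refine hp.eq_of_forall_apply_eq fun k => ?_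
  have hscalar := congr(($(neg_mul_mul_slope_exp_neg (b k) t) : ℂ))
  push_cast at hscalar
  rw [diagonalSemigroup_of_re_pos ht', map_sub, map_smul,
    hp.apply_diagonalMultiplier (hb.isNullOfVariationLE_exp ht'),
    hp.apply_diagonalMultiplier (isNullOfVariationLE_slope_exp hb ht),
    (mem_graph_diagonalOperator hp).1 hxy k, smul_smul, smul_smul, mul_assoc, hscalar, sub_smul,
    one_smul]

theorem isInfinitesimalGenerator_neg_diagonalOperator [CompleteSpace X]
    (hp : IsCoordinateProjections p) (hb : IsEigenvalueSequence b) :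
    IsInfinitesimalGenerator (-diagonalOperator p b) (diagonalSemigroup p b) := by
  have hlimit {x y : X} (hxy : (x, y) ∈ (diagonalOperator p b).graph) :
      Tendsto (fun t : ℝ => (t : ℂ)⁻¹ • (diagonalSemigroup p b t x - x)) (𝓝[>] 0) (𝓝 (-y)) := by
    refine (hp.tendsto_diagonalMultiplier_apply (V := 1)
      (c := fun (t : ℝ) k => (slope Real.exp 0 (-(b k * t)) : ℂ))
      (eventually_mem_nhdsWithin.mono fun t ht => isNullOfVariationLE_slope_exp hb ht)
      (fun k => by exact_mod_cast (tendsto_slope_exp_neg_mul (hb.pos k)).ofReal) y).neg.congr' ?_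
    filter_upwards [self_mem_nhdsWithin] with t ht
    have ht0 : (t : ℂ) ≠ 0 := Complex.ofReal_ne_zero.2 (ne_of_gt ht)
    rw [diagonalSemigroup_sub_eq_of_mem_graph hp hb hxy ht, smul_smul, mul_neg,
      inv_mul_cancel₀ ht0, neg_one_smul]
  have hneg (x y : X) : (x, y) ∈ (-diagonalOperator p b).graph ↔
      (x, -y) ∈ (diagonalOperator p b).graph := by
    simp [LinearPMap.mem_graph_iff, neg_eq_iff_eq_neg]
  refine fun x y => (hneg x y).trans ⟨fun h => by simpa using hlimit h, fun h => ?_⟩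
  refine (mem_graph_diagonalOperator hp).2 fun k => ?_
  rw [map_neg, neg_eq_iff_eq_neg]
  refine tendsto_nhds_unique (((p k).continuous.tendsto y).comp h)
    ((hlimit (apply_mem_graph_diagonalOperator hp k x)).congr' ?_)
  filter_upwards [self_mem_nhdsWithin] with t ht
  have ht' : 0 < (t : ℂ).re := ht
  have hnull := hb.isNullOfVariationLE_exp ht'
  rw [Function.comp_apply, map_smul, map_sub, diagonalSemigroup_of_re_pos ht',
    hp.apply_diagonalMultiplier hnull, hp.diagonalMultiplier_apply hnull]

theorem generatesBoundedAnalyticSemigroup_neg_diagonalOperator [CompleteSpace X]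
    (hp : IsCoordinateProjections p) (hb : IsEigenvalueSequence b) :
    GeneratesBoundedAnalyticSemigroup (-diagonalOperator p b) :=
  ⟨diagonalSemigroup p b, isBoundedAnalyticSemigroup_diagonalSemigroup hp hb,
    isInfinitesimalGenerator_neg_diagonalOperator hp hb⟩

end Generation

section Interval

variable {X : Type*} [NormedAddCommGroup X]

theorem memLp_restrict_Ico_of_continuous {f : ℝ → X}
    (hf : Continuous f) (a b : ℝ) (q : ENNReal) : MemLp f q (volume.restrict (Ico a b)) := by
  obtain ⟨C, hC⟩ := isCompact_Icc.exists_bound_of_continuousOn (s := Icc a b) hf.continuousOn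
  refine MemLp.of_bound hf.aestronglyMeasurable C ?_
  filter_upwards [ae_restrict_mem measurableSet_Ico] with t ht
  exact hC t (Ico_subset_Icc_self ht)

variable [NormedSpace ℝ X]

theorem eq_integral_of_hasDerivAt [CompleteSpace X] {u v : ℝ → X} (hu0 : u 0 = 0)
    (hu : ∀ t, HasDerivAt u (v t) t) (hv : Continuous v) (t : ℝ) :
    u t = ∫ s in (0 : ℝ)..t, v s := by
  rw [intervalIntegral.integral_eq_sub_of_hasDerivAt (fun s _ => hu s)
    (hv.intervalIntegrable _ _), hu0, sub_zero]

theorem enorm_integral_le_eLpNorm_two {v : ℝ → X} (hv : Continuous v) {τ : ℝ}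
    (hτ : 0 ≤ τ) : ‖∫ t in (0 : ℝ)..τ, v t‖ₑ ≤
      eLpNorm v 2 (volume.restrict (Ioc 0 τ)) * ENNReal.ofReal τ ^ (2⁻¹ : ℝ) := by
  rw [intervalIntegral.integral_of_le hτ]
  refine (enorm_integral_le_lintegral_enorm _).trans ?_
  rw [← eLpNorm_one_eq_lintegral_enorm]
  refine (eLpNorm_le_eLpNorm_mul_rpow_measure_univ one_le_two hv.aestronglyMeasurable).trans_eq ?_
  rw [Measure.restrict_apply_univ, Real.volume_Ioc, sub_zero]
  norm_num

theorem enorm_apply_le_eLpNorm_two [CompleteSpace X] {u v w : ℝ → X} (hu0 : u 0 = 0)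
    (hu : ∀ t, HasDerivAt u (v t) t) (hv : Continuous v) (hw : Continuous w) {τ T : ℝ}
    (hτ : 0 ≤ τ) (hτT : τ ≤ T) {C : ENNReal}
    (hC : eLpNorm w 2 (volume.restrict (Ioc 0 T)) ≤
      C * eLpNorm (v + w) 2 (volume.restrict (Ioc 0 T))) :
    ‖u τ‖ₑ ≤ (1 + C) * ENNReal.ofReal τ ^ (2⁻¹ : ℝ) *
      eLpNorm (v + w) 2 (volume.restrict (Ioc 0 T)) := by
  have hv_le : eLpNorm v 2 (volume.restrict (Ioc 0 T)) ≤
      (1 + C) * eLpNorm (v + w) 2 (volume.restrict (Ioc 0 T)) := by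
    nth_rw 1 [← add_sub_cancel_right v w]
    rw [one_add_mul]
    exact (eLpNorm_sub_le (hv.add hw).aestronglyMeasurable hw.aestronglyMeasurable
      one_le_two).trans (add_le_add_right hC _)
  rw [eq_integral_of_hasDerivAt hu0 hu hv, mul_right_comm]
  refine (enorm_integral_le_eLpNorm_two hv hτ).trans ?_
  gcongr
  exact (eLpNorm_mono_measure v
    (Measure.restrict_mono (Ioc_subset_Ioc_right hτT) le_rfl)).trans hv_le

end Interval

section MaximalRegularity

variable {X : Type*} [NormedAddCommGroup X] [NormedSpace ℂ X] {T : ℝ} {B : X →ₗ.[ℂ] X}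

namespace HasTimeApply

variable {u u' w w' : TimeL2 T X}

theorem add (h : HasTimeApply B u w) (h' : HasTimeApply B u' w') :
    HasTimeApply B (u + u') (w + w') := by
  filter_upwards [h, h', Lp.coeFn_add u u', Lp.coeFn_add w w'] with t ht ht' hu hw
  rw [hu, hw]
  exact B.graph.add_mem ht ht'

theorem smul (h : HasTimeApply B u w) (a : ℂ) : HasTimeApply B (a • u) (a • w) := by
  filter_upwards [h, Lp.coeFn_smul a u, Lp.coeFn_smul a w] with t ht hu hw
  rw [hu, hw]
  exact B.graph.smul_mem a ht

theorem unique (h : HasTimeApply B u w) (h' : HasTimeApply B u w') : w = w' := by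
  refine Lp.ext ?_
  filter_upwards [h, h'] with t ht ht'
  exact B.mem_graph_snd_inj ht ht' rfl

theorem of_tendsto (hB : B.IsClosed) {u w : ℕ → TimeL2 T X} (h : ∀ n, HasTimeApply B (u n) (w n))
    (hu : Tendsto u atTop (𝓝 u')) (hw : Tendsto w atTop (𝓝 w')) : HasTimeApply B u' w' := by
  obtain ⟨φ, hφ, huφ⟩ := (tendstoInMeasure_of_tendsto_Lp hu).exists_seq_tendsto_ae
  obtain ⟨ψ, hψ, hwψ⟩ :=
    (tendstoInMeasure_of_tendsto_Lp (hw.comp hφ.tendsto_atTop)).exists_seq_tendsto_ae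
  filter_upwards [ae_all_iff.2 h, huφ, hwψ] with t ht hut hwt
  exact hB.mem_of_tendsto ((hut.comp hψ.tendsto_atTop).prodMk_nhds hwt)
    (Eventually.of_forall fun n => ht _)

end HasTimeApply

variable [CompleteSpace X]

/- `f ↦ B (R f)` is everywhere defined and has a closed graph. -/
theorem MaximalRegularity.exists_norm_le (hB : B.IsClosed) (h : MaximalRegularity T B) :
    ∃ C : NNReal, ∀ u v w : TimeL2 T X, HasTimeDeriv u v → HasTimeApply B u w →
      ‖w‖ₑ ≤ C * ‖v + w‖ₑ := by
  obtain ⟨R, hR⟩ := h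
  have hdom (f : TimeL2 T X) : ∃ w, HasTimeApply B (R f) w :=
    let ⟨_, w, _, hw, _⟩ := (hR f (R f)).1 rfl
    ⟨w, hw⟩
  choose BR hBR using hdom
  let BRlinear : TimeL2 T X →ₗ[ℂ] TimeL2 T X :=
    { toFun := BR
      map_add' := fun f g => (hBR (f + g)).unique (by rw [map_add]; exact (hBR f).add (hBR g))
      map_smul' := fun a f => (hBR (a • f)).unique (by rw [map_smul]; exact (hBR f).smul a) }
  let BRclosed : TimeL2 T X →L[ℂ] TimeL2 T X :=
    .ofSeqClosedGraph (g := BRlinear) fun f g w hf hw =>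
      (HasTimeApply.of_tendsto hB (fun n => hBR (f n)) ((R.continuous.tendsto g).comp hf) hw).unique
        (hBR g)
  refine ⟨‖BRclosed‖₊, fun u v w hv hw => ?_⟩
  have hu : R (v + w) = u := (hR (v + w) u).2 ⟨v, w, hv, hw, rfl⟩
  have hwA : w = BRclosed (v + w) := hw.unique (hu ▸ hBR (v + w))
  calc ‖w‖ₑ = ‖BRclosed (v + w)‖ₑ := by rw [← hwA]
    _ ≤ ‖BRclosed‖ₑ * ‖v + w‖ₑ := BRclosed.le_opENorm _

theorem hasTimeDeriv_toLp {u v : ℝ → X} (hu0 : u 0 = 0) (hu : ∀ t, HasDerivAt u (v t) t)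
    (hv : Continuous v) (hu2 : MemLp u 2 (volume.restrict (Ico 0 T)))
    (hv2 : MemLp v 2 (volume.restrict (Ico 0 T))) :
    HasTimeDeriv (hu2.toLp u) (hv2.toLp v) := by
  filter_upwards [hu2.coeFn_toLp, ae_restrict_mem measurableSet_Ico] with t ht htT
  rw [ht, eq_integral_of_hasDerivAt hu0 hu hv, intervalIntegral.integral_of_le htT.1,
    intervalIntegral.integral_of_le htT.1]
  exact (integral_congr_ae (ae_restrict_of_ae_restrict_of_subset
    (fun s hs => ⟨hs.1.le, hs.2.trans_lt htT.2⟩ : Ioc 0 t ⊆ Ico 0 T) hv2.coeFn_toLp)).symm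

theorem MaximalRegularity.exists_eLpNorm_le (hB : B.IsClosed) (h : MaximalRegularity T B) :
    ∃ C : NNReal, ∀ u v w : ℝ → X, u 0 = 0 → (∀ t, HasDerivAt u (v t) t) → Continuous v →
      Continuous w → (∀ t, (u t, w t) ∈ B.graph) →
      eLpNorm w 2 (volume.restrict (Ioc 0 T)) ≤
        C * eLpNorm (v + w) 2 (volume.restrict (Ioc 0 T)) := by
  obtain ⟨C, hC⟩ := h.exists_norm_le hB
  refine ⟨C, fun u v w hu0 hu hv hw huw => ?_⟩
  have hu2 := memLp_restrict_Ico_of_continuous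
    (continuous_iff_continuousAt.2 fun t => (hu t).continuousAt) 0 T 2
  have hv2 := memLp_restrict_Ico_of_continuous hv 0 T 2
  have hw2 := memLp_restrict_Ico_of_continuous hw 0 T 2
  have hBuw : HasTimeApply B (hu2.toLp u) (hw2.toLp w) := by
    filter_upwards [hu2.coeFn_toLp, hw2.coeFn_toLp] with t htu htw
    rw [htu, htw]
    exact huw t
  have hle := hC _ _ _ (hasTimeDeriv_toLp hu0 hu hv hu2 hv2) hBuw
  rwa [← MemLp.toLp_add, Lp.enorm_toLp, Lp.enorm_toLp,
    Measure.restrict_congr_set Ico_ae_eq_Ioc] at hle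

end MaximalRegularity

section Periodic

variable {X : Type*} [NormedAddCommGroup X] [NormedSpace ℂ X] {p : ℕ → X →L[ℂ] X} {b : ℕ → ℝ}

theorem one_le_slope_exp {x : ℝ} (hx : 0 < x) : 1 ≤ slope Real.exp 0 x := by
  rw [slope_def_field, Real.exp_zero, sub_zero, one_le_div hx]
  linarith [Real.add_one_le_exp x]

theorem antitone_exp_mul_inv_slope_exp (hb : IsEigenvalueSequence b) {s τ : ℝ} (hs : 0 ≤ s)
    (hτ : 0 < τ) : Antitone fun k => Real.exp (-(b k * s)) * (slope Real.exp 0 (b k * τ))⁻¹ := by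
  intro k l hkl
  have hpos (k : ℕ) : 0 < b k * τ := mul_pos (hb.pos k) hτ
  have hbkl := hb.monotone hkl
  have hslope : slope Real.exp 0 (b k * τ) ≤ slope Real.exp 0 (b l * τ) :=
    convexOn_exp.slope_mono (mem_univ 0) ⟨mem_univ _, (hpos k).ne'⟩ ⟨mem_univ _, (hpos l).ne'⟩
      (by gcongr)
  have hslope_pos (k : ℕ) := zero_lt_one.trans_le (one_le_slope_exp (hpos k))
  exact mul_le_mul (by gcongr) (inv_anti₀ (hslope_pos k) hslope) (inv_pos.2 (hslope_pos l)).le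
    (Real.exp_pos _).le

theorem mul_exp_neg_eq_slope {β : ℝ} (hβ : 0 < β) {τ : ℝ} (hτ : 0 < τ) (t : ℝ) :
    β * Real.exp (-(β * t)) = τ⁻¹ * (Real.exp (-(β * (t - τ))) * (slope Real.exp 0 (β * τ))⁻¹) *
      (1 - Real.exp (-(β * τ))) := by
  have hexp : Real.exp (-(β * t)) = Real.exp (-(β * (t - τ))) * Real.exp (-(β * τ)) := by
    rw [← Real.exp_add]
    ring_nf
  have hone : Real.exp (-(β * τ)) * Real.exp (β * τ) = 1 := by
    rw [← Real.exp_add, neg_add_cancel, Real.exp_zero]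
  have hne : Real.exp (β * τ) - 1 ≠ 0 := (sub_pos.2 (Real.one_lt_exp_iff.2 (mul_pos hβ hτ))).ne'
  rw [hexp, slope_def_field, Real.exp_zero, sub_zero]
  field_simp
  linear_combination hone

/- For `t ≥ τ` the operator `A e^{-tA} (1 - e^{-τA})⁻¹` has decreasing coefficients. -/
theorem norm_truncatedDiagonal_mul_exp_le {K : ℝ} (hp : OrthogonalIdempotents p)
    (hb : IsEigenvalueSequence b) (hK : ∀ n, ‖∑ k ∈ Finset.range n, p k‖ ≤ K) {τ t : ℝ}
    (hτ : 0 < τ) (hτt : τ ≤ t) (m : ℕ) (x : X) :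
    ‖truncatedDiagonal p (fun k => b k * Complex.exp (-(b k * t))) m x‖ ≤
      τ⁻¹ * K * ‖truncatedDiagonal p (fun k => 1 - Complex.exp (-(b k * τ))) m x‖ := by
  let a (k : ℕ) : ℝ := Real.exp (-(b k * (t - τ))) * (slope Real.exp 0 (b k * τ))⁻¹
  have hslope (k : ℕ) := one_le_slope_exp (mul_pos (hb.pos k) hτ)
  have ha : Antitone a := antitone_exp_mul_inv_slope_exp hb (sub_nonneg.2 hτt) hτ
  have ha0 (k : ℕ) : 0 ≤ a k := by have := hslope k; positivity
  have ha1 : a 0 ≤ 1 := mul_le_one₀ (Real.exp_le_one_iff.2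
    (neg_nonpos.2 (mul_nonneg (hb.pos 0).le (sub_nonneg.2 hτt)))) (by have := hslope 0; positivity)
    (inv_le_one_of_one_le₀ (hslope 0))
  have hfactor : (fun k => b k * Complex.exp (-(b k * t))) =
      (τ⁻¹ : ℂ) • ((fun k => (a k : ℂ)) * fun k => 1 - Complex.exp (-(b k * τ))) := by
    ext k
    simp only [Pi.smul_apply, Pi.mul_apply, smul_eq_mul, a, ← mul_assoc]
    exact_mod_cast mul_exp_neg_eq_slope (hb.pos k) hτ t
  rw [hfactor, truncatedDiagonal_smul, ← truncatedDiagonal_mul_truncatedDiagonal hp, smul_apply,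
    mul_apply_eq_comp, norm_smul, norm_inv, Complex.norm_real, Real.norm_of_nonneg hτ.le, mul_assoc]
  gcongr
  refine ContinuousLinearMap.le_of_opNorm_le _ ?_ _
  exact (norm_truncatedDiagonal_le_of_antitone hK ha ha0 m).trans
    (mul_le_of_le_one_left ((norm_nonneg _).trans (hK 0)) ha1)

theorem truncatedDiagonal_mem_graph (hp : IsCoordinateProjections p) (c : ℕ → ℂ) (m : ℕ) (x : X) :
    (truncatedDiagonal p c m x, truncatedDiagonal p (fun k => b k * c k) m x) ∈
      (diagonalOperator p b).graph := by
  have hsum : (truncatedDiagonal p c m x, truncatedDiagonal p (fun k => b k * c k) m x) =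
      ∑ k ∈ Finset.range m, c k • (p k x, (b k : ℂ) • p k x) := by
    simp only [truncatedDiagonal_apply, Prod.ext_iff, Prod.fst_sum, Prod.snd_sum, Prod.smul_mk,
      smul_smul, mul_comm (c _), and_self]
  rw [hsum]
  exact Submodule.sum_mem _ fun k _ =>
    Submodule.smul_mem _ _ (apply_mem_graph_diagonalOperator hp k x)

theorem hasDerivAt_truncatedDiagonal_exp (m : ℕ) (x : X) (t : ℝ) :
    HasDerivAt (fun t : ℝ => truncatedDiagonal p (fun k => Complex.exp (-(b k * t))) m x)
      (-truncatedDiagonal p (fun k => b k * Complex.exp (-(b k * t))) m x) t := by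
  simp only [truncatedDiagonal_apply, ← Finset.sum_neg_distrib, ← neg_smul]
  refine HasDerivAt.fun_sum fun k _ => HasDerivAt.smul_const ?_ _
  convert! ((hasDerivAt_id t).ofReal_comp.const_mul (b k : ℂ)).fun_neg.cexp using 1
  simp only [id_eq, Complex.ofReal_one, mul_one]
  ring

theorem continuous_truncatedDiagonal_mul_exp (m : ℕ) (x : X) :
    Continuous fun t : ℝ => truncatedDiagonal p (fun k => b k * Complex.exp (-(b k * t))) m x := by
  simp only [truncatedDiagonal_apply]
  fun_prop

theorem eLpNorm_truncatedDiagonal_mul_exp_le {K : ℝ} (hp : OrthogonalIdempotents p)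
    (hb : IsEigenvalueSequence b) (hK : ∀ n, ‖∑ k ∈ Finset.range n, p k‖ ≤ K) {τ : ℝ}
    (hτ : 0 < τ) (T : ℝ) (m : ℕ) (x : X) :
    eLpNorm (fun t : ℝ => truncatedDiagonal p (fun k => b k * Complex.exp (-(b k * t))) m x) 2
        (volume.restrict (Ioc τ T)) ≤
      ENNReal.ofReal (T - τ) ^ (2⁻¹ : ℝ) * ENNReal.ofReal (τ⁻¹ * K) *
        ‖truncatedDiagonal p (fun k => 1 - Complex.exp (-(b k * τ))) m x‖ₑ := by
  have hK0 : 0 ≤ K := (norm_nonneg _).trans (hK 0)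
  rw [mul_assoc, ← ofReal_norm, ← ENNReal.ofReal_mul (by positivity)]
  have hle : ∀ᵐ t : ℝ ∂volume.restrict (Ioc τ T),
      ‖truncatedDiagonal p (fun k => b k * Complex.exp (-(b k * t))) m x‖ ≤
        τ⁻¹ * K * ‖truncatedDiagonal p (fun k => 1 - Complex.exp (-(b k * τ))) m x‖ := by
    filter_upwards [ae_restrict_mem measurableSet_Ioc] with t ht
    exact norm_truncatedDiagonal_mul_exp_le hp hb hK hτ ht.1.le m x
  simpa only [Measure.restrict_apply_univ, Real.volume_Ioc, ENNReal.toReal_ofNat] using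
    eLpNorm_le_of_ae_bound (p := 2) hle

theorem exists_zero_initial_value (hp : IsCoordinateProjections p) {m : ℕ} {g g' : ℝ → X}
    (hg : ∀ t, HasDerivAt g (g' t) t) (hg' : Continuous g')
    (hgm : ∀ t, truncatedDiagonal p 1 m (g t) = g t) :
    ∃ u v w : ℝ → X, u 0 = 0 ∧ (∀ t, HasDerivAt u (v t) t) ∧ Continuous v ∧ Continuous w ∧
      (∀ t, (u t, w t) ∈ (diagonalOperator p b).graph) ∧
      (v + w = fun t => g' t + truncatedDiagonal p (fun k => b k) m (g t)) ∧
      (∀ t, u t = g t - truncatedDiagonal p (fun k => Complex.exp (-(b k * t))) m (g 0)) ∧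
      ∀ t, truncatedDiagonal p (fun k => b k) m (g t) =
        w t + truncatedDiagonal p (fun k => b k * Complex.exp (-(b k * t))) m (g 0) := by
  have hgc : Continuous g := continuous_iff_continuousAt.2 fun t => (hg t).continuousAt
  have hc := continuous_truncatedDiagonal_mul_exp (p := p) (b := b) m (g 0)
  refine ⟨fun t => g t - truncatedDiagonal p (fun k => Complex.exp (-(b k * t))) m (g 0),
    fun t => g' t + truncatedDiagonal p (fun k => b k * Complex.exp (-(b k * t))) m (g 0),
    fun t => truncatedDiagonal p (fun k => b k) m (g t) -
      truncatedDiagonal p (fun k => b k * Complex.exp (-(b k * t))) m (g 0),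
    ?_, fun t => ?_, hg'.add hc, (by fun_prop : Continuous fun t => _).sub hc, fun t => ?_, ?_,
    fun t => rfl, fun t => (sub_add_cancel _ _).symm⟩
  · have hone : (fun k => Complex.exp (-(b k * (0 : ℝ)))) = 1 := by ext k; simp
    simp only [hone, hgm, sub_self]
  · simpa only [sub_neg_eq_add] using! (hg t).sub (hasDerivAt_truncatedDiagonal_exp m (g 0) t)
  · have hgt := truncatedDiagonal_mem_graph (b := b) hp 1 m (g t)
    simp only [hgm, Pi.one_apply, mul_one] at hgt
    exact Submodule.sub_mem _ hgt (truncatedDiagonal_mem_graph hp _ m (g 0))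
  · ext t
    simp only [Pi.add_apply]
    abel

/- Subtracting `e^{-tA} g(0)` from `g` produces a function to which the initial value problem
applies; the error `A e^{-tA} g(0)` is harmless once `t ≥ τ`. -/
theorem MaximalRegularity.exists_eLpNorm_le_of_eq [CompleteSpace X]
    (hp : IsCoordinateProjections p) (hb : IsEigenvalueSequence b) {τ : ℝ} (hτ : 0 < τ)
    (h : MaximalRegularity (2 * τ) (diagonalOperator p b)) :
    ∃ D : ENNReal, D ≠ ⊤ ∧ ∀ (m : ℕ) (g g' : ℝ → X), (∀ t, HasDerivAt g (g' t) t) →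
      Continuous g' → (∀ t, truncatedDiagonal p 1 m (g t) = g t) → g τ = g 0 →
      eLpNorm (fun t => truncatedDiagonal p (fun k => b k) m (g t)) 2
          (volume.restrict (Ioc τ (2 * τ))) ≤
        D * eLpNorm (fun t => g' t + truncatedDiagonal p (fun k => b k) m (g t)) 2
          (volume.restrict (Ioc 0 (2 * τ))) := by
  obtain ⟨K, hK⟩ := hp.exists_norm_sum_le
  obtain ⟨C, hC⟩ := h.exists_eLpNorm_le (isClosed_diagonalOperator hp)
  let L : ENNReal := ENNReal.ofReal (2 * τ - τ) ^ (2⁻¹ : ℝ) * ENNReal.ofReal (τ⁻¹ * K)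
  refine ⟨C + L * ((1 + C) * ENNReal.ofReal τ ^ (2⁻¹ : ℝ)), by finiteness,
    fun m g g' hg hg' hgm hgτ => ?_⟩
  obtain ⟨u, v, w, hu0, hu, hv, hw, huw, hvw, hug, hgw⟩ :=
    exists_zero_initial_value (b := b) hp hg hg' hgm
  have hCw := hC u v w hu0 hu hv hw huw
  have huτ : u τ = truncatedDiagonal p (fun k => 1 - Complex.exp (-(b k * τ))) m (g 0) := by
    rw [hug, hgτ]
    nth_rw 1 [← hgm 0]
    simp only [truncatedDiagonal_apply, ← Finset.sum_sub_distrib, ← sub_smul, Pi.one_apply]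
  have huτ_le := enorm_apply_le_eLpNorm_two hu0 hu hv hw hτ.le (by linarith) hCw
  have herror := eLpNorm_truncatedDiagonal_mul_exp_le hp.toOrthogonalIdempotents hb hK hτ (2 * τ) m
    (g 0)
  rw [← huτ] at herror
  rw [hvw] at hCw huτ_le
  simp only [hgw]
  have hsub : Ioc τ (2 * τ) ⊆ Ioc 0 (2 * τ) := Ioc_subset_Ioc_left hτ.le
  refine (eLpNorm_add_le hw.aestronglyMeasurable
    (continuous_truncatedDiagonal_mul_exp m (g 0)).aestronglyMeasurable one_le_two).trans ?_
  rw [add_mul]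
  refine add_le_add ((eLpNorm_mono_measure w (Measure.restrict_mono hsub le_rfl)).trans ?_)
    (herror.trans ?_)
  · simpa only [hgw] using hCw
  · rw [mul_assoc L]
    exact mul_le_mul' le_rfl (by simpa only [hgw] using huτ_le)

end Periodic

section Circle

variable {τ : ℝ} [Fact (0 < τ)] {Y : Type*} [NormedAddCommGroup Y]

theorem measurePreserving_mk_Ioc_two_mul :
    MeasurePreserving (QuotientAddGroup.mk : ℝ → AddCircle τ) (volume.restrict (Ioc 0 (2 * τ)))
      ((2 : ENNReal) • volume) := by
  have hτ : 0 < τ := Fact.out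
  have hmk (t : ℝ) := AddCircle.measurePreserving_mk τ t
  refine ⟨(hmk 0).measurable, ?_⟩
  rw [← Ioc_union_Ioc_eq_Ioc hτ.le (by linarith : τ ≤ 2 * τ),
    Measure.restrict_union (Ioc_disjoint_Ioc_of_le le_rfl) measurableSet_Ioc,
    Measure.map_add _ _ (hmk 0).measurable, two_smul, two_mul]
  congr 1
  · simpa only [zero_add] using (hmk 0).map_eq
  · exact (hmk τ).map_eq

theorem eLpNorm_restrict_Ioc_two_mul {G : AddCircle τ → Y} (hG : Continuous G) :
    eLpNorm (fun t : ℝ => G t) 2 (volume.restrict (Ioc 0 (2 * τ))) =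
      2 ^ (2⁻¹ : ℝ) * eLpNorm G 2 volume := by
  refine (eLpNorm_comp_measurePreserving hG.aestronglyMeasurable
    measurePreserving_mk_Ioc_two_mul).trans ?_
  simp [eLpNorm_smul_measure_of_ne_top]

theorem eLpNorm_restrict_Ioc_self_two_mul {G : AddCircle τ → Y} (hG : Continuous G) :
    eLpNorm (fun t : ℝ => G t) 2 (volume.restrict (Ioc τ (2 * τ))) = eLpNorm G 2 volume := by
  rw [two_mul]
  exact eLpNorm_comp_measurePreserving hG.aestronglyMeasurable
    (AddCircle.measurePreserving_mk τ τ)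

theorem eLpNorm_volume_addCircle (G : AddCircle τ → Y) :
    eLpNorm G 2 volume = ENNReal.ofReal τ ^ (2⁻¹ : ℝ) * eLpNorm G 2 AddCircle.haarAddCircle := by
  rw [AddCircle.volume_eq_smul_haarAddCircle, eLpNorm_smul_measure_of_ne_top ENNReal.ofNat_ne_top]
  simp

theorem MaximalRegularity.exists_eLpNorm_addCircle_le {X : Type*} [NormedAddCommGroup X]
    [NormedSpace ℂ X] [CompleteSpace X] {p : ℕ → X →L[ℂ] X} {b : ℕ → ℝ}
    (h : MaximalRegularity (2 * τ) (diagonalOperator p b)) (hp : IsCoordinateProjections p)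
    (hb : IsEigenvalueSequence b) :
    ∃ D : NNReal, ∀ (m : ℕ) (G G' : AddCircle τ → X),
      (∀ t : ℝ, HasDerivAt (fun s : ℝ => G s) (G' t) t) → Continuous G → Continuous G' →
      (∀ t, truncatedDiagonal p 1 m (G t) = G t) →
      eLpNorm (fun t => truncatedDiagonal p (fun k => b k) m (G t)) 2 AddCircle.haarAddCircle ≤
        D * eLpNorm (fun t => G' t + truncatedDiagonal p (fun k => b k) m (G t)) 2
          AddCircle.haarAddCircle := by
  have hτ : 0 < τ := Fact.out
  obtain ⟨D, hD, hline⟩ := h.exists_eLpNorm_le_of_eq hp hb hτ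
  lift D * 2 ^ (2⁻¹ : ℝ) to NNReal using by finiteness with D' hD'
  refine ⟨D', fun m G G' hGG' hG hG' hGm => ?_⟩
  have hAG : Continuous fun t => truncatedDiagonal p (fun k => b k) m (G t) := by fun_prop
  have hle := hline m (fun s => G s) (fun s => G' s) hGG'
    (hG'.comp (AddCircle.continuous_mk' τ)) (fun t => hGm t)
    (by simp only [AddCircle.coe_period, QuotientAddGroup.mk_zero])
  rw [eLpNorm_restrict_Ioc_self_two_mul hAG, eLpNorm_restrict_Ioc_two_mul (hG'.fun_add hAG),
    ← mul_assoc, ← hD', eLpNorm_volume_addCircle, eLpNorm_volume_addCircle, mul_left_comm] at hle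
  refine (ENNReal.mul_le_mul_iff_right ?_ (by finiteness)).1 hle
  simpa using hτ

end Circle

section TrigPolynomial

variable {τ : ℝ} {Y : Type*} [NormedAddCommGroup Y] [NormedSpace ℂ Y]

variable (τ) in
/-- The `Y`-valued trigonometric polynomial `t ↦ ∑ j, e^{2πijt/τ} x j` on the circle of
length `τ`, as a linear function of its coefficients. -/
def trigPolynomial : (ℤ →₀ Y) →ₗ[ℂ] C(AddCircle τ, Y) :=
  Finsupp.lsum ℂ fun j =>
    { toFun y := ⟨fun t => fourier j t • y, by fun_prop⟩
      map_add' y z := by ext t; simp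
      map_smul' c y := by ext t; simp [smul_comm c] }

theorem trigPolynomial_single (j : ℤ) (y : Y) (t : AddCircle τ) :
    trigPolynomial τ (Finsupp.single j y) t = fourier j t • y := by
  rw [trigPolynomial, Finsupp.lsum_single]
  rfl

/-- The Fourier multiplier with operator-valued symbol `M`, acting on the coefficients of
trigonometric polynomials. -/
def fourierMultiplier (M : ℤ → Y →L[ℂ] Y) : (ℤ →₀ Y) →ₗ[ℂ] ℤ →₀ Y :=
  Finsupp.lsum ℂ fun j => Finsupp.lsingle j ∘ₗ (M j).toLinearMap

theorem fourierMultiplier_single (M : ℤ → Y →L[ℂ] Y) (j : ℤ) (y : Y) :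
    fourierMultiplier M (Finsupp.single j y) = Finsupp.single j (M j y) := by
  simp [fourierMultiplier]

theorem fourierMultiplier_apply (M : ℤ → Y →L[ℂ] Y) (x : ℤ →₀ Y) (j : ℤ) :
    fourierMultiplier M x j = M j (x j) := by
  induction x using Finsupp.induction_linear with
  | zero => simp
  | add x y hx hy => simp [hx, hy]
  | single i y =>
    rw [fourierMultiplier_single]
    obtain rfl | hij := eq_or_ne i j
    · simp
    · simp [hij]

theorem fourierMultiplier_mul (M N : ℤ → Y →L[ℂ] Y) (x : ℤ →₀ Y) :
    fourierMultiplier (M * N) x = fourierMultiplier M (fourierMultiplier N x) := by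
  ext j
  simp only [fourierMultiplier_apply, Pi.mul_apply, mul_apply_eq_comp]

theorem fourierMultiplier_add (M N : ℤ → Y →L[ℂ] Y) (x : ℤ →₀ Y) :
    fourierMultiplier (M + N) x = fourierMultiplier M x + fourierMultiplier N x := by
  ext j
  simp only [fourierMultiplier_apply, Pi.add_apply, add_apply, Finsupp.add_apply]

theorem apply_trigPolynomial (A : Y →L[ℂ] Y) (x : ℤ →₀ Y) (t : AddCircle τ) :
    A (trigPolynomial τ x t) = trigPolynomial τ (fourierMultiplier (fun _ => A) x) t := by
  induction x using Finsupp.induction_linear with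
  | zero => simp
  | add x y hx hy => simp [hx, hy]
  | single j y => simp [fourierMultiplier_single, trigPolynomial_single]

/-- The eigenvalue of `d/dt` on the circle of length `τ` at the character `fourier j`. -/
def derivEigenvalue (τ : ℝ) (j : ℤ) : ℂ :=
  2 * Real.pi * Complex.I * j / τ

theorem re_derivEigenvalue (τ : ℝ) (j : ℤ) : (derivEigenvalue τ j).re = 0 := by
  simp [derivEigenvalue, Complex.div_re]

theorem hasDerivAt_trigPolynomial (x : ℤ →₀ Y) (t : ℝ) :
    HasDerivAt (fun s : ℝ => trigPolynomial τ x s)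
      (trigPolynomial τ (fourierMultiplier (fun j => derivEigenvalue τ j • 1) x) t) t := by
  induction x using Finsupp.induction_linear with
  | zero => simpa using! hasDerivAt_const t (0 : Y)
  | add x y hx hy => simpa using! hx.add hy
  | single j y =>
    simp only [fourierMultiplier_single, trigPolynomial_single]
    convert! (hasDerivAt_fourier τ j t).smul_const y using 1
    simp [smul_smul, derivEigenvalue, mul_comm]

variable [Fact (0 < τ)]

variable (τ) in
/-- The class in `L²` of a trigonometric polynomial, for the normalized measure on the circle. -/
def trigLp : (ℤ →₀ Y) →ₗ[ℂ] Lp Y 2 (AddCircle.haarAddCircle (T := τ)) :=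
  (ContinuousMap.toLp 2 AddCircle.haarAddCircle ℂ).toLinearMap ∘ₗ trigPolynomial τ

theorem coeFn_trigLp (x : ℤ →₀ Y) :
    trigLp τ x =ᵐ[AddCircle.haarAddCircle] trigPolynomial τ x :=
  ContinuousMap.coeFn_toLp _ _

theorem enorm_trigLp (x : ℤ →₀ Y) :
    ‖trigLp τ x‖ₑ = eLpNorm (trigPolynomial τ x) 2 AddCircle.haarAddCircle := by
  rw [Lp.enorm_def, eLpNorm_congr_ae (coeFn_trigLp x)]

variable (τ) in
/-- The Fourier multiplier with symbol `M` has norm at most `D` on `L²` of the circle of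
length `τ`. -/
def IsFourierMultiplierBound (M : ℤ → Y →L[ℂ] Y) (D : NNReal) : Prop :=
  ∀ x : ℤ →₀ Y, ‖trigLp τ (fourierMultiplier M x)‖ ≤ D * ‖trigLp τ x‖

theorem isFourierMultiplierBound_const (A : Y →L[ℂ] Y) :
    IsFourierMultiplierBound τ (fun _ => A) ‖A‖₊ := fun x => by
  have hA : trigLp τ (fourierMultiplier (fun _ => A) x) = A.compLp (trigLp τ x) := by
    refine Lp.ext ?_
    filter_upwards [coeFn_trigLp (fourierMultiplier (fun _ => A) x), coeFn_trigLp x,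
      A.coeFn_compLp (trigLp τ x)] with t h1 h2 h3
    rw [h1, h3, h2, apply_trigPolynomial]
  rw [hA]
  exact A.norm_compLp_le _

end TrigPolynomial

section Resolvent

variable {X : Type*} [NormedAddCommGroup X] [NormedSpace ℂ X] {p : ℕ → X →L[ℂ] X} {b : ℕ → ℝ}

theorem smul_one_add_truncatedDiagonal_mul (hp : OrthogonalIdempotents p) {c : ℕ → ℂ} {z : ℂ}
    (hz : ∀ k, c k + z ≠ 0) (m : ℕ) :
    (z • 1 + truncatedDiagonal p c m) * truncatedDiagonal p (fun k => (c k + z)⁻¹) m =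
      truncatedDiagonal p 1 m := by
  rw [add_mul, smul_one_mul, truncatedDiagonal_mul_truncatedDiagonal hp, ← truncatedDiagonal_smul,
    ← truncatedDiagonal_add]
  congr 1
  ext k
  simp only [Pi.add_apply, Pi.smul_apply, Pi.mul_apply, smul_eq_mul, Pi.one_apply]
  rw [← add_mul, add_comm, mul_inv_cancel₀ (hz k)]

variable {τ : ℝ} [Fact (0 < τ)]

theorem MaximalRegularity.exists_norm_trigLp_le [CompleteSpace X]
    (h : MaximalRegularity (2 * τ) (diagonalOperator p b)) (hp : IsCoordinateProjections p)
    (hb : IsEigenvalueSequence b) :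
    ∃ D : NNReal, ∀ (m : ℕ) (y : ℤ →₀ X),
      fourierMultiplier (fun _ => truncatedDiagonal p 1 m) y = y →
      ‖trigLp τ (fourierMultiplier (fun _ => truncatedDiagonal p (fun k => b k) m) y)‖ ≤
        D * ‖trigLp τ (fourierMultiplier ((fun j => derivEigenvalue τ j • 1) +
          fun _ => truncatedDiagonal p (fun k => b k) m) y)‖ := by
  obtain ⟨D, hD⟩ := h.exists_eLpNorm_addCircle_le hp hb
  refine ⟨D, fun m y hy => ?_⟩
  have hle := hD m (trigPolynomial τ y)
    (trigPolynomial τ (fourierMultiplier (fun j => derivEigenvalue τ j • 1) y))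
    (hasDerivAt_trigPolynomial y) (map_continuous _) (map_continuous _)
    (fun t => by rw [apply_trigPolynomial, hy])
  simp only [apply_trigPolynomial, ← ContinuousMap.add_apply, ← map_add, ← fourierMultiplier_add,
    ← enorm_trigLp, enorm_eq_nnnorm] at hle
  exact_mod_cast hle

/- The function with coefficients `(A + 2πij/τ)⁻¹ x j` solves the periodic problem
`G' + A G = F`, where `F` has coefficients `x j`. -/
theorem MaximalRegularity.exists_isFourierMultiplierBound [CompleteSpace X]
    (h : MaximalRegularity (2 * τ) (diagonalOperator p b)) (hp : IsCoordinateProjections p)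
    (hb : IsEigenvalueSequence b) :
    ∃ D : NNReal, ∀ m, IsFourierMultiplierBound τ
      (fun j => truncatedDiagonal p (fun k => b k / (b k + derivEigenvalue τ j)) m) D := by
  obtain ⟨K, hK⟩ := hp.exists_norm_sum_le
  obtain ⟨D, hD⟩ := h.exists_norm_trigLp_le hp hb
  lift K to NNReal using (norm_nonneg _).trans (hK 0)
  refine ⟨D * K, fun m x => ?_⟩
  let A : ℤ → X →L[ℂ] X := fun _ => truncatedDiagonal p (fun k => b k) m
  let R : ℤ → X →L[ℂ] X := fun j => truncatedDiagonal p (fun k => (b k + derivEigenvalue τ j)⁻¹) m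
  have hmul (c d : ℕ → ℂ) :=
    truncatedDiagonal_mul_truncatedDiagonal hp.toOrthogonalIdempotents c d m
  have hAR : A * R = fun j =>
      truncatedDiagonal p (fun k => b k / (b k + derivEigenvalue τ j)) m := funext fun j => hmul _ _
  have hone : (fun _ => truncatedDiagonal p 1 m) * R = R := funext fun j => by
    simp only [Pi.mul_apply, R, hmul, one_mul]
  have hsolve : ((fun j => derivEigenvalue τ j • 1) + A) * R = fun _ => truncatedDiagonal p 1 m :=
    funext fun j => smul_one_add_truncatedDiagonal_mul hp.toOrthogonalIdempotents
      (fun k h0 => (hb.pos k).ne' (by simpa [re_derivEigenvalue] using congr(Complex.re $h0))) m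
  have hle := hD m (fourierMultiplier R x) (by rw [← fourierMultiplier_mul, hone])
  rw [← fourierMultiplier_mul, ← fourierMultiplier_mul, hAR, hsolve] at hle
  rw [NNReal.coe_mul, mul_assoc]
  have hK1 : ‖truncatedDiagonal p 1 m‖ ≤ K := truncatedDiagonal_one p m ▸ hK m
  exact hle.trans (mul_le_mul_of_nonneg_left ((isFourierMultiplierBound_const _ x).trans
    (mul_le_mul_of_nonneg_right hK1 (norm_nonneg _))) D.2)

end Resolvent

section Pairing

variable {α : Type*} [MeasurableSpace α] {μ : Measure α} {X : Type*} [NormedAddCommGroup X]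
  [NormedSpace ℂ X]

variable (μ X) in
/-- The pairing `(Φ, f) ↦ ∫ Φ(t) (f t) dμ` of `L²(μ; X*)` with `L²(μ; X)`. -/
def dualPairing : Lp (StrongDual ℂ X) 2 μ →L[ℂ] StrongDual ℂ (Lp X 2 μ) :=
  (ContinuousLinearMap.id ℂ (StrongDual ℂ X)).lpPairing μ 2 2

theorem dualPairing_apply (Φ : Lp (StrongDual ℂ X) 2 μ) (f : Lp X 2 μ) :
    dualPairing μ X Φ f = ∫ t, Φ t (f t) ∂μ :=
  ContinuousLinearMap.lpPairing_eq_integral _ _ _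

theorem integrable_dual_apply (Φ : Lp (StrongDual ℂ X) 2 μ) (f : Lp X 2 μ) :
    Integrable (fun t => Φ t (f t)) μ :=
  memLp_one_iff_integrable.1 ((ContinuousLinearMap.id ℂ (StrongDual ℂ X)).memLp_of_bilin 1
    (Lp.memLp Φ) (Lp.memLp f))

theorem norm_dualPairing_apply_le (Φ : Lp (StrongDual ℂ X) 2 μ) (f : Lp X 2 μ) :
    ‖dualPairing μ X Φ f‖ ≤ ‖Φ‖ * ‖f‖ := by
  let B := ContinuousLinearMap.id ℂ (StrongDual ℂ X)
  have hB : ‖B‖ ≤ 1 := ContinuousLinearMap.norm_id_le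
  calc ‖dualPairing μ X Φ f‖ = ‖∫ t, B.holder 1 Φ f t ∂μ‖ := by
        rw [dualPairing_apply, integral_congr_ae (B.coeFn_holder (r := 1) Φ f)]
        rfl
    _ ≤ ‖B.holder 1 Φ f‖ :=
        (norm_integral_le_integral_norm _).trans_eq (L1.norm_eq_integral_norm _).symm
    _ ≤ ‖B‖ * ‖Φ‖ * ‖f‖ := B.norm_holder_apply_apply_le Φ f
    _ ≤ ‖Φ‖ * ‖f‖ := by
        rw [mul_assoc]
        exact mul_le_of_le_one_left (by positivity) hB

theorem norm_sq_eq_integral_norm_sq {F : Type*} [NormedAddCommGroup F] (f : Lp F 2 μ) :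
    ‖f‖ ^ 2 = ∫ t, ‖f t‖ ^ 2 ∂μ := by
  have h := lpNorm_nnreal_eq_integral_norm_rpow (p := 2) two_ne_zero (Lp.aestronglyMeasurable f)
  rw [← toReal_eLpNorm (Lp.aestronglyMeasurable f)] at h
  simp only [NNReal.coe_ofNat, Real.rpow_two, ENNReal.coe_ofNat] at h
  rw [Lp.norm_def, h, ← Real.rpow_natCast, ← Real.rpow_mul (integral_nonneg fun t => sq_nonneg _)]
  simp

theorem exists_almost_norming (φ : StrongDual ℂ X) {r : ℝ} (hr : r < 1) :
    ∃ x : X, ‖x‖ ≤ ‖φ‖ ∧ r * ‖φ‖ ^ 2 ≤ (φ x).re := by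
  obtain rfl | hφ := eq_or_ne φ 0
  · exact ⟨0, by simp, by simp⟩
  have hφ0 : 0 < ‖φ‖ := norm_pos_iff.2 hφ
  obtain ⟨x, hx, hφx⟩ := φ.exists_lt_apply_of_lt_opNorm (mul_lt_of_lt_one_left hφ0 hr)
  obtain ⟨c, hc, hcφ⟩ := RCLike.exists_norm_eq_mul_self (φ x)
  refine ⟨(‖φ‖ * c : ℂ) • x, ?_, ?_⟩
  · rw [norm_smul, norm_mul, hc, Complex.norm_real, norm_norm, mul_one]
    exact mul_le_of_le_one_right hφ0.le hx.le
  · replace hcφ : c * φ x = (‖φ x‖ : ℂ) := hcφ.symm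
    rw [map_smul, smul_eq_mul, mul_assoc, hcφ, Complex.re_ofReal_mul, Complex.ofReal_re]
    nlinarith

theorem exists_almost_norming_Lp (Φ : Lp.simpleFunc (StrongDual ℂ X) 2 μ) {r : ℝ} (hr : r < 1) :
    ∃ f : Lp X 2 μ, ‖f‖ ≤ ‖Φ‖ ∧ r * ‖Φ‖ ^ 2 ≤ (dualPairing μ X Φ f).re := by
  choose g hg hgr using fun φ : StrongDual ℂ X => exists_almost_norming φ hr
  let s := Lp.simpleFunc.toSimpleFunc Φ
  have hs : s =ᵐ[μ] Φ := Lp.simpleFunc.toSimpleFunc_eq_toFun Φ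
  have hf : MemLp (s.map g) 2 μ := (Lp.simpleFunc.memLp Φ).mono
    (SimpleFunc.aestronglyMeasurable _) (.of_forall fun t => hg (s t))
  have hfΦ : ∀ᵐ t ∂μ, hf.toLp _ t = g ((Φ : Lp (StrongDual ℂ X) 2 μ) t) := by
    filter_upwards [hf.coeFn_toLp, hs] with t ht hst
    rw [ht, ← hst, SimpleFunc.map_apply]
  refine ⟨hf.toLp _, Lp.norm_le_norm_of_ae_le ?_, ?_⟩
  · filter_upwards [hfΦ] with t ht
    rw [ht]
    exact hg _
  · have hint := integrable_dual_apply (Φ : Lp (StrongDual ℂ X) 2 μ) (hf.toLp _)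
    have hnorm : ‖Φ‖ ^ 2 = _ := norm_sq_eq_integral_norm_sq (Φ : Lp (StrongDual ℂ X) 2 μ)
    rw [dualPairing_apply, ← RCLike.re_eq_complex_re, ← integral_re hint, hnorm,
      ← integral_const_mul]
    refine integral_mono_ae ?_ hint.re ?_
    · exact (Lp.memLp _).integrable_norm_pow two_ne_zero |>.const_mul r
    · filter_upwards [hfΦ] with t ht
      rw [ht]
      exact hgr _

theorem norm_le_norm_dualPairing (Φ : Lp (StrongDual ℂ X) 2 μ) : ‖Φ‖ ≤ ‖dualPairing μ X Φ‖ := by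
  induction Φ using (Lp.simpleFunc.denseRange (p := 2) ENNReal.ofNat_ne_top).induction_on with
  | hp => exact isClosed_le continuous_norm (by fun_prop)
  | ih Φ =>
    obtain h0 | h0 := (norm_nonneg Φ).eq_or_lt
    · exact h0.symm.le.trans (norm_nonneg _)
    refine le_of_forall_lt_imp_le_of_dense fun c hc => le_of_mul_le_mul_right ?_ h0
    obtain ⟨f, hf, hfc⟩ := exists_almost_norming_Lp Φ ((div_lt_one h0).2 hc)
    calc c * ‖Φ‖ = c / ‖Φ‖ * ‖Φ‖ ^ 2 := by field_simp
      _ ≤ (dualPairing μ X Φ f).re := hfc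
      _ ≤ ‖dualPairing μ X Φ f‖ := Complex.re_le_norm _
      _ ≤ ‖dualPairing μ X Φ‖ * ‖Φ‖ := ContinuousLinearMap.le_of_opNorm_le_of_le _ le_rfl hf

end Pairing

section Duality

variable {τ : ℝ} [Fact (0 < τ)] {X : Type*} [NormedAddCommGroup X] [NormedSpace ℂ X]

theorem trigLp_single (j : ℤ) (x : X) :
    trigLp τ (Finsupp.single j x) =
      (ContinuousLinearMap.toSpanSingleton ℂ x).compLp (fourierLp 2 j) := by
  refine Lp.ext ?_
  filter_upwards [coeFn_trigLp (τ := τ) (Finsupp.single j x), coeFn_fourierLp (T := τ) 2 j,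
    (ContinuousLinearMap.toSpanSingleton ℂ x).coeFn_compLp (fourierLp (T := τ) 2 j)] with t h1 h2 h3
  rw [h1, h3, h2, trigPolynomial_single, ContinuousLinearMap.toSpanSingleton_apply]

theorem indicatorConstLp_eq_compLp_one {α : Type*} [MeasurableSpace α] {μ : Measure α} {s : Set α}
    (hs : MeasurableSet s) (hμs : μ s ≠ ⊤) (x : X) :
    indicatorConstLp 2 hs hμs x =
      (ContinuousLinearMap.toSpanSingleton ℂ x).compLp (indicatorConstLp 2 hs hμs 1) := by
  refine Lp.ext ?_
  filter_upwards [indicatorConstLp_coeFn (p := 2) (hs := hs) (hμs := hμs) (c := x),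
    indicatorConstLp_coeFn (p := 2) (hs := hs) (hμs := hμs) (c := (1 : ℂ)),
    (ContinuousLinearMap.toSpanSingleton ℂ x).coeFn_compLp (indicatorConstLp 2 hs hμs 1)]
    with t h1 h2 h3
  rw [h1, h3, h2]
  by_cases ht : t ∈ s <;> simp [ht]

theorem denseRange_trigLp :
    DenseRange (trigLp τ : (ℤ →₀ X) → Lp X 2 (AddCircle.haarAddCircle (T := τ))) := by
  let V := (LinearMap.range (trigLp τ (Y := X))).topologicalClosure
  have hscalar (x : X) (φ : Lp ℂ 2 (AddCircle.haarAddCircle (T := τ))) :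
      (ContinuousLinearMap.toSpanSingleton ℂ x).compLp φ ∈ V := by
    let Ψ := (ContinuousLinearMap.toSpanSingleton ℂ x).compLpL 2 (AddCircle.haarAddCircle (T := τ))
    have hspan : Submodule.span ℂ (range (fourierLp (T := τ) 2)) ≤ V.comap Ψ.toLinearMap :=
      Submodule.span_le.2 <| range_subset_iff.2 fun j =>
        Submodule.le_topologicalClosure _ ⟨Finsupp.single j x, trigLp_single j x⟩
    have hle := Submodule.topologicalClosure_minimal _ hspan
      ((Submodule.isClosed_topologicalClosure _).preimage Ψ.continuous)
    rw [span_fourierLp_closure_eq_top ENNReal.ofNat_ne_top] at hle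
    exact hle (Submodule.mem_top (x := φ))
  refine fun f => Lp.induction ENNReal.ofNat_ne_top (· ∈ V) (fun x s hs hμs => ?_)
    (fun f g hf hg _ hfV hgV => V.add_mem hfV hgV) (Submodule.isClosed_topologicalClosure _) f
  rw [Lp.simpleFunc.coe_indicatorConst, indicatorConstLp_eq_compLp_one]
  exact hscalar x _

theorem integral_fourier_eq_zero {n : ℤ} (hn : n ≠ 0) :
    ∫ t : AddCircle τ, fourier n t ∂AddCircle.haarAddCircle = 0 :=
  integral_eq_zero_of_add_right_eq_neg (fourier_add_half_inv_index hn Fact.out)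

theorem dualPairing_trigLp_single (i j : ℤ) (φ : StrongDual ℂ X) (x : X) :
    dualPairing AddCircle.haarAddCircle X (trigLp τ (Finsupp.single i φ))
      (trigLp τ (Finsupp.single j x)) = if j = -i then φ x else 0 := by
  have hint : dualPairing AddCircle.haarAddCircle X (trigLp τ (Finsupp.single i φ))
      (trigLp τ (Finsupp.single j x)) =
      (∫ t : AddCircle τ, fourier (i + j) t ∂AddCircle.haarAddCircle) * φ x := by
    rw [dualPairing_apply, ← integral_mul_const]
    refine integral_congr_ae ?_
    filter_upwards [coeFn_trigLp (τ := τ) (Finsupp.single i φ),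
      coeFn_trigLp (τ := τ) (Finsupp.single j x)] with t h1 h2
    rw [h1, h2, trigPolynomial_single, trigPolynomial_single, smul_apply, map_smul, fourier_add,
      smul_eq_mul, smul_eq_mul, mul_assoc]
  rw [hint]
  split_ifs with hij
  · simp [hij]
  · rw [integral_fourier_eq_zero (by omega), zero_mul]

theorem dualPairing_fourierMultiplier (M : ℤ → X →L[ℂ] X) (φ : ℤ →₀ StrongDual ℂ X) (x : ℤ →₀ X) :
    dualPairing AddCircle.haarAddCircle X
        (trigLp τ (fourierMultiplier (fun j => dualAdjoint (M (-j))) φ)) (trigLp τ x) =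
      dualPairing AddCircle.haarAddCircle X (trigLp τ φ) (trigLp τ (fourierMultiplier M x)) := by
  induction φ using Finsupp.induction_linear with
  | zero => simp
  | add φ ψ hφ hψ => simp only [map_add, add_apply, hφ, hψ]
  | single i φ =>
    induction x using Finsupp.induction_linear with
    | zero => simp
    | add x y hx hy => simp only [map_add, hx, hy]
    | single j x =>
      simp only [fourierMultiplier_single, dualPairing_trigLp_single]
      split_ifs with hij
      · rw [hij]
        rfl
      · rfl

theorem IsFourierMultiplierBound.dual {M : ℤ → X →L[ℂ] X} {D : NNReal}
    (h : IsFourierMultiplierBound τ M D) :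
    IsFourierMultiplierBound τ (fun j => dualAdjoint (M (-j))) D := fun φ => by
  refine (norm_le_norm_dualPairing _).trans (ContinuousLinearMap.opNorm_le_bound _ (by positivity)
    fun f => ?_)
  refine denseRange_trigLp.induction_on f (isClosed_le (by fun_prop) (by fun_prop)) fun x => ?_
  rw [dualPairing_fourierMultiplier]
  calc _ ≤ ‖trigLp τ φ‖ * ‖trigLp τ (fourierMultiplier M x)‖ := norm_dualPairing_apply_le _ _
    _ ≤ ‖trigLp τ φ‖ * (D * ‖trigLp τ x‖) := mul_le_mul_of_nonneg_left (h x) (norm_nonneg _)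
    _ = D * ‖trigLp τ φ‖ * ‖trigLp τ x‖ := by ring

end Duality

section Lacunary

variable {τ : ℝ} {Y : Type*} [NormedAddCommGroup Y] [NormedSpace ℂ Y]

/-- The coefficients of the trigonometric polynomial `∑_{n=1}^N y_n e^{2πi 2^n t/τ}`. -/
def lacunaryCoeff (N : ℕ) (y : ℕ → Y) : ℤ →₀ Y :=
  ∑ n ∈ Finset.Icc 1 N, Finsupp.single (2 ^ n) (y n)

theorem trigPolynomial_lacunaryCoeff (N : ℕ) (y : ℕ → Y) (t : ℝ) :
    trigPolynomial τ (lacunaryCoeff N y) t =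
      ∑ n ∈ Finset.Icc 1 N,
        Complex.exp (Complex.I * 2 ^ n * (2 * Real.pi / τ * t : ℝ)) • y n := by
  simp only [lacunaryCoeff, map_sum, ContinuousMap.sum_apply, trigPolynomial_single,
    fourier_coe_apply]
  refine Finset.sum_congr rfl fun n _ => ?_
  congr 2
  push_cast
  ring

variable [Fact (0 < τ)]

variable (τ) in
theorem lacunaryNorm_eq_norm_trigLp (N : ℕ) (y : ℕ → Y) :
    lacunaryNorm N y = ‖trigLp τ (lacunaryCoeff N y)‖ := by
  have hτ : 0 < τ := Fact.out
  let F : ℝ → ℝ := fun s => ‖∑ n ∈ Finset.Icc 1 N, Complex.exp (Complex.I * 2 ^ n * s) • y n‖ ^ 2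
  have hsq : ‖trigLp τ (lacunaryCoeff N y)‖ ^ 2 = ∫ s in 0..2 * Real.pi, F s / (2 * Real.pi) :=
    calc ‖trigLp τ (lacunaryCoeff N y)‖ ^ 2
        = ∫ t, ‖trigPolynomial τ (lacunaryCoeff N y) t‖ ^ 2 ∂AddCircle.haarAddCircle := by
          rw [norm_sq_eq_integral_norm_sq]
          refine integral_congr_ae ?_
          filter_upwards [coeFn_trigLp (τ := τ) (lacunaryCoeff N y)] with t ht
          rw [ht]
      _ = τ⁻¹ * ∫ t in 0..τ, F (2 * Real.pi / τ * t) := by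
          rw [AddCircle.integral_haarAddCircle, ← AddCircle.intervalIntegral_preimage τ 0, zero_add,
            smul_eq_mul]
          simp only [trigPolynomial_lacunaryCoeff, F]
      _ = ∫ s in 0..2 * Real.pi, F s / (2 * Real.pi) := by
          rw [intervalIntegral.integral_comp_mul_left F (by positivity),
            intervalIntegral.integral_div, mul_zero, div_mul_cancel₀ _ hτ.ne', smul_eq_mul]
          field_simp
  rw [← Real.sqrt_sq (norm_nonneg (trigLp τ _)), hsq]
  rfl

theorem IsFourierMultiplierBound.lacunaryNorm_le {M : ℤ → Y →L[ℂ] Y} {D : NNReal}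
    (h : IsFourierMultiplierBound τ M D) {α β : ℂ} (hαβ : α ≠ β) {N : ℕ} {u w : ℕ → Y}
    (hM : ∀ n ∈ Finset.Icc 1 N, M (2 ^ n) (u n) = α • (u n - w n) + β • w n) :
    lacunaryNorm N w ≤ ‖β - α‖⁻¹ * (D + ‖α‖) * lacunaryNorm N u := by
  have hβα : β - α ≠ 0 := sub_ne_zero.2 hαβ.symm
  have hw : lacunaryCoeff N w =
      (β - α)⁻¹ • (fourierMultiplier M (lacunaryCoeff N u) - α • lacunaryCoeff N u) := by
    rw [eq_inv_smul_iff₀ hβα]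
    simp only [lacunaryCoeff, map_sum, fourierMultiplier_single, Finset.smul_sum,
      Finsupp.smul_single, ← Finset.sum_sub_distrib, ← Finsupp.single_sub]
    refine Finset.sum_congr rfl fun n hn => ?_
    rw [hM n hn]
    congr 1
    module
  rw [lacunaryNorm_eq_norm_trigLp τ, lacunaryNorm_eq_norm_trigLp τ, hw, map_smul, map_sub,
    map_smul, norm_smul, norm_inv, mul_assoc]
  refine mul_le_mul_of_nonneg_left ((norm_sub_le _ _).trans ?_) (by positivity)
  rw [norm_smul, add_mul]
  exact add_le_add_left (h _) _

theorem truncatedDiagonal_apply_of_add_eq {p : ℕ → Y →L[ℂ] Y} (hp : OrthogonalIdempotents p)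
    (c : ℕ → ℂ) {i j m : ℕ} (hi : i < m) (hj : j < m) {y : Y} (hy : p i y + p j y = y) :
    truncatedDiagonal p c m y = c i • (y - p j y) + c j • p j y := by
  have hblock {k : ℕ} (hk : k < m) : truncatedDiagonal p c m (p k y) = c k • p k y := by
    rw [← mul_apply_eq_comp, truncatedDiagonal_mul hp, if_pos hk, smul_apply]
  calc truncatedDiagonal p c m y
      = truncatedDiagonal p c m (p i y + p j y) := by rw [hy]
    _ = c i • p i y + c j • p j y := by rw [map_add, hblock hi, hblock hj]
    _ = c i • (y - p j y) + c j • p j y := by rw [← eq_sub_of_add_eq hy]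

theorem apply_add_apply_of_mem_closedSpan {A B : Y →L[ℂ] Y} (hA : IsIdempotentElem A)
    (hB : IsIdempotentElem B) (hAB : A * B = 0) (hBA : B * A = 0) {y : Y}
    (hy : y ∈ closedSpan (LinearMap.range A.toLinearMap) (LinearMap.range B.toLinearMap)) :
    A y + B y = y := by
  have hker : closedSpan (LinearMap.range A.toLinearMap) (LinearMap.range B.toLinearMap) ≤
      (A + B - 1).ker := by
    refine Submodule.topologicalClosure_minimal _ (Submodule.span_le.2 (union_subset ?_ ?_))
      (ContinuousLinearMap.isClosed_ker _)
    · rintro _ ⟨x, rfl⟩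
      change ((A + B - 1) * A) x = 0
      rw [sub_mul, add_mul, hA.eq, hBA, one_mul, add_zero, sub_self, zero_apply]
    · rintro _ ⟨x, rfl⟩
      change ((A + B - 1) * B) x = 0
      rw [sub_mul, add_mul, hB.eq, hAB, one_mul, zero_add, sub_self, zero_apply]
  exact sub_eq_zero.1 (hker hy)

/-- Eigenvalues which on the pair of blocks with indices `2 * l` and `2 * l + 1` are half the
frequency `2π 2 ^ (l + 1) / τ`, respectively equal to it. -/
def dyadicEigenvalue (τ : ℝ) (k : ℕ) : ℝ :=
  2 * Real.pi / τ * 2 ^ ((k + 1) / 2)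

theorem isEigenvalueSequence_dyadicEigenvalue : IsEigenvalueSequence (dyadicEigenvalue τ) := by
  have hτ : 0 < τ := Fact.out
  have hτ' : 0 < 2 * Real.pi / τ := by positivity
  refine ⟨fun k => by unfold dyadicEigenvalue; positivity, Monotone.const_mul (fun k l hkl => ?_)
    hτ'.le, Tendsto.const_mul_atTop hτ' ?_⟩
  · exact pow_le_pow_right₀ one_le_two (Nat.div_le_div_right (by omega))
  · exact (tendsto_pow_atTop_atTop_of_one_lt one_lt_two).comp
      ((Nat.tendsto_div_const_atTop two_ne_zero).comp (tendsto_add_atTop_nat 1))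

/-- The factor by which the resolvent multiplier of the dyadic diagonal operator acts on the
`k`-th block at the frequency `j`. -/
def dyadicSymbol (τ : ℝ) (j : ℤ) (k : ℕ) : ℂ :=
  dyadicEigenvalue τ k / (dyadicEigenvalue τ k + derivEigenvalue τ j)

theorem dyadicSymbol_two_mul (s : ℤ) (l : ℕ) :
    dyadicSymbol τ (s * 2 ^ (l + 1)) (2 * l) = 1 / (1 + 2 * s * Complex.I) := by
  have hτ : (τ : ℂ) ≠ 0 := Complex.ofReal_ne_zero.2 (Fact.out : 0 < τ).ne'
  have hω : (2 * Real.pi / τ * 2 ^ l : ℂ) ≠ 0 := by simp [hτ]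
  rw [dyadicSymbol, dyadicEigenvalue, derivEigenvalue, show (2 * l + 1) / 2 = l by omega,
    ← mul_div_mul_left 1 _ hω]
  push_cast
  congr 1 <;> ring

theorem dyadicSymbol_two_mul_add_one (s : ℤ) (l : ℕ) :
    dyadicSymbol τ (s * 2 ^ (l + 1)) (2 * l + 1) = 1 / (1 + s * Complex.I) := by
  have hτ : (τ : ℂ) ≠ 0 := Complex.ofReal_ne_zero.2 (Fact.out : 0 < τ).ne'
  have hω : (2 * Real.pi / τ * 2 ^ (l + 1) : ℂ) ≠ 0 := by simp [hτ]
  rw [dyadicSymbol, dyadicEigenvalue, derivEigenvalue, show (2 * l + 1 + 1) / 2 = l + 1 by omega,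
    ← mul_div_mul_left 1 _ hω]
  push_cast
  congr 1 <;> ring

theorem exists_lacunaryNorm_le_of_dyadicSymbol {Q : ℕ → Y →L[ℂ] Y}
    (hQ : OrthogonalIdempotents fun k => Q (k + 1)) {s : ℤ} (hs : s ≠ 0) {D : NNReal}
    (hD : ∀ m, IsFourierMultiplierBound τ
      (fun j => truncatedDiagonal (fun k => Q (k + 1)) (dyadicSymbol τ (s * j)) m) D) :
    ∃ C : ℝ, ∀ (N : ℕ) (u : ℕ → Y),
      (∀ n ∈ Finset.Icc 1 N, u n ∈ closedSpan (LinearMap.range (Q (2 * n - 1)).toLinearMap)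
        (LinearMap.range (Q (2 * n)).toLinearMap)) →
      lacunaryNorm N (fun n => Q (2 * n) (u n)) ≤ C * lacunaryNorm N u := by
  have hαβ : (1 / (1 + 2 * s * Complex.I) : ℂ) ≠ 1 / (1 + s * Complex.I) := by
    intro h
    rw [one_div, one_div, inv_inj, add_right_inj] at h
    have h2s : (2 * s : ℂ) = s := mul_right_cancel₀ Complex.I_ne_zero h
    norm_cast at h2s
    omega
  refine ⟨_, fun N u hu => (hD (2 * N)).lacunaryNorm_le hαβ fun n hn => ?_⟩
  obtain ⟨hn1, hnN⟩ := Finset.mem_Icc.1 hn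
  obtain ⟨l, rfl⟩ := Nat.exists_eq_add_of_le' hn1
  have hmem := hu (l + 1) hn
  rw [show 2 * (l + 1) - 1 = 2 * l + 1 by omega, Nat.mul_succ] at hmem
  have hsum := apply_add_apply_of_mem_closedSpan (hQ.idem (2 * l)) (hQ.idem (2 * l + 1))
    (hQ.ortho (Nat.lt_succ_self _).ne) (hQ.ortho (Nat.lt_succ_self _).ne') hmem
  rw [truncatedDiagonal_apply_of_add_eq hQ _ (by omega) (by omega) hsum, dyadicSymbol_two_mul,
    dyadicSymbol_two_mul_add_one, Nat.mul_succ]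

end Lacunary

section Blocks

variable {X : Type*} [NormedAddCommGroup X] [NormedSpace ℂ X]
  {E : ℕ → Submodule ℂ X} {P : ℕ → X →L[ℂ] X}

theorem dualAdjoint_truncatedDiagonal (p : ℕ → X →L[ℂ] X) (c : ℕ → ℂ) (m : ℕ) :
    dualAdjoint (truncatedDiagonal p c m) = truncatedDiagonal (fun k => dualAdjoint (p k)) c m := by
  ext φ x
  simp [dualAdjoint, truncatedDiagonal]

theorem orthogonalIdempotents_dualAdjoint {p : ℕ → X →L[ℂ] X} (hp : OrthogonalIdempotents p) :
    OrthogonalIdempotents fun k => dualAdjoint (p k) where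
  idem k := congr(dualAdjoint $(hp.idem k))
  ortho k l hkl := by
    change dualAdjoint (p l * p k) = 0
    rw [hp.ortho hkl.symm]
    ext φ _
    exact map_zero φ

theorem IsSchauderDecomposition.eq_range (h : IsSchauderDecomposition E P) {n : ℕ} (hn : 1 ≤ n) :
    E n = LinearMap.range (P n).toLinearMap := by
  ext x
  refine ⟨fun hx => ⟨x, ?_⟩, ?_⟩
  · simpa using h.apply_of_mem hn hx hn
  · rintro ⟨y, rfl⟩
    exact h.mem n hn y

theorem HasMRP.exists_isFourierMultiplierBound [CompleteSpace X] {τ : ℝ} [Fact (0 < τ)]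
    (hX : HasMRP (2 * τ) X) {p : ℕ → X →L[ℂ] X} (hp : IsCoordinateProjections p) :
    ∃ D : NNReal, ∀ m, IsFourierMultiplierBound τ
      (fun j => truncatedDiagonal p (dyadicSymbol τ j) m) D :=
  have hb : IsEigenvalueSequence (dyadicEigenvalue τ) := isEigenvalueSequence_dyadicEigenvalue
  (hX (diagonalOperator p (dyadicEigenvalue τ))
    (generatesBoundedAnalyticSemigroup_neg_diagonalOperator hp
      hb)).exists_isFourierMultiplierBound hp hb

end Blocks

end

theorem theorem3p1 {X : Type*} [NormedAddCommGroup X] [NormedSpace ℂ X] [CompleteSpace X]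
    (E : ℕ → Submodule ℂ X) (P : ℕ → X →L[ℂ] X) (hEP : IsSchauderDecomposition E P)
    (T : ℝ) (hT : 0 < T) (hX : HasMRP T X) :
    ∃ C : ℝ, 0 < C ∧
      (∀ (N : ℕ) (u : ℕ → X),
        (∀ n ∈ Finset.Icc 1 N, u n ∈ closedSpan (E (2 * n - 1)) (E (2 * n))) →
        lacunaryNorm N (fun n => P (2 * n) (u n)) ≤ C * lacunaryNorm N u) ∧
      (∀ (N : ℕ) (u : ℕ → StrongDual ℂ X),
        (∀ n ∈ Finset.Icc 1 N,
          u n ∈ closedSpan (dualRange (P (2 * n - 1))) (dualRange (P (2 * n)))) →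
        lacunaryNorm N (fun n => dualAdjoint (P (2 * n)) (u n)) ≤ C * lacunaryNorm N u) := by
  obtain ⟨τ, rfl⟩ : ∃ τ, T = 2 * τ := ⟨T / 2, by ring⟩
  have : Fact (0 < τ) := ⟨by linarith⟩
  have hp := hEP.isCoordinateProjections
  obtain ⟨D, hD⟩ := hX.exists_isFourierMultiplierBound hp
  obtain ⟨C₁, hC₁⟩ := exists_lacunaryNorm_le_of_dyadicSymbol hp.toOrthogonalIdempotents one_ne_zero
    (D := D) (by simpa only [one_mul] using hD)
  obtain ⟨C₂, hC₂⟩ := exists_lacunaryNorm_le_of_dyadicSymbol (Q := fun n => dualAdjoint (P n))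
    (orthogonalIdempotents_dualAdjoint hp.toOrthogonalIdempotents) (neg_ne_zero.2 one_ne_zero)
    (D := D) (by simpa only [neg_one_mul, dualAdjoint_truncatedDiagonal] using fun m => (hD m).dual)
  refine ⟨max 1 (max C₁ C₂), by positivity, fun N u hu => (hC₁ N u fun n hn => ?_).trans ?_,
    fun N u hu => (hC₂ N u hu).trans ?_⟩
  · have hn1 := (Finset.mem_Icc.1 hn).1
    rw [← hEP.eq_range (by omega), ← hEP.eq_range (by omega)]
    exact hu n hn
  all_goals exact mul_le_mul_of_nonneg_right (by simp) (Real.sqrt_nonneg _)
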